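/- Let $p\in\mathbb{C}$, $p\neq 0$. Let $\mathcal{S}(p)$ be the Lie conformal superalgebra which is the free $\mathbb{C}[\partial]$-module with even basis elements $L_i,W_i$ and odd basis elements $G_i$ $(i\in\mathbb{Z}_{\ge 0})$ and with $\lambda$-brackets $$[L_i\,{}_\lambda\,L_j]=\big((i+p)\partial+(i+j+2p)\lambda\big)L_{i+j},\qquad [L_i\,{}_\lambda\,W_j]=\big((i+p)\partial+(i+j+p)\lambda\big)W_{i+j},$$ $$[L_i\,{}_\lambda\,G_j]=\big((i+p)\partial+(i+j+2p)\lambda\big)G_{i+j},\qquad [W_i\,{}_\lambda\,G_j]=G_{i+j},\qquad [W_i\,{}_\lambda\,W_j]=[G_i\,{}_\lambda\,G_j]=0 .$$ Define the following conformal $\mathcal{S}(p)$-modules $\mathbb{C}[\partial]v_{\bar 0}\oplus\mathbb{C}[\partial]v_{\bar 1}$, with $v_{\bar 0}$ even and $v_{\bar 1}$ odd. All $\lambda$-actions of generators $L_i,W_i,G_i$ on $v_{\bar 0},v_{\bar 1}$ that are not listed are zero. Parameters are complex numbers, $\sigma\ne0$, and $c=c'=0$ unless $p=-1$. * $V_{a,b,c,d,a',b',c',d'}$: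 $\;L_0\,{}_\lambda\,v_{\bar 0}=p(\partial+a\lambda+b)v_{\bar 0}$, $L_1\,{}_\lambda\,v_{\bar 0}=c\,v_{\bar 0}$, $W_0\,{}_\lambda\,v_{\bar 0}=d\,v_{\bar 0}$; $\;L_0\,{}_\lambda\,v_{\bar 1}=p(\partial+a'\lambda+b')v_{\bar 1}$, $L_1\,{}_\lambda\,v_{\bar 1}=c'v_{\bar 1}$, $W_0\,{}_\lambda\,v_{\bar 1}=d'v_{\bar 1}$. * $V_{a,b,c,d,\sigma}$: $\;L_0\,{}_\lambda\,v_{\bar 0}=p(\partial+a\lambda+b)v_{\bar 0}$, $L_1\,{}_\lambda\,v_{\bar 0}=c\,v_{\bar 0}$, $W_0\,{}_\lambda\,v_{\bar 0}=d\,v_{\bar 0}$, $G_0\,{}_\lambda\,v_{\bar 0}=\sigma v_{\bar 1}$; $\;L_0\,{}_\lambda\,v_{\bar 1}=p(\partial+(a+1)\lambda+b)v_{\bar 1}$, $L_1\,{}_\lambda\,v_{\bar 1}=c\,v_{\bar 1}$, $W_0\,{}_\lambda\,v_{\bar 1}=(d+1)v_{\bar 1}$. * $V_{a,b,\sigma}$: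 $\;L_0\,{}_\lambda\,v_{\bar 0}=p(\partial+a\lambda+b)v_{\bar 0}$, $W_0\,{}_\lambda\,v_{\bar 0}=(a-1)v_{\bar 0}$, $G_0\,{}_\lambda\,v_{\bar 0}=\sigma(\partial+a\lambda+b)v_{\bar 1}$; $\;L_0\,{}_\lambda\,v_{\bar 1}=p(\partial+a\lambda+b)v_{\bar 1}$, $W_0\,{}_\lambda\,v_{\bar 1}=a\,v_{\bar 1}$. For a conformal module $V=V_{\bar 0}\oplus V_{\bar 1}$ let $\Pi(V)$ be the same module with the even and odd parts exchanged. **Theorem.** Let $V=V_{\bar 0}\oplus V_{\bar 1}$ be a conformal $\mathcal{S}(p)$-module that is free over $\mathbb{C}[\partial]$ of rank $1+1$ (that is, $V_{\bar 0}$ and $V_{\bar 1}$ both have rank $1$), and suppose that $V$ is non-trivial in each parity: $\mathcal{S}(p)$ acts neither on $V_{\bar 0}$ nor on $V_{\bar 1}$ by zero. Then $V$ is isomorphic, by a parity-preserving isomorphism of conformal modules, to one of $$V_{a,b,c,d,a',b',c',d'},\quad V_{a,b,c,d,\sigma},\quad V_{a,b,\sigma},\quad \Pi(V_{a-1,b,c,d-1,\sigma}),\quad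 \Pi(V_{a,b,\sigma})$$ for some $a,b,c,d,a',b',c',d'\in\mathbb{C}$ and $\sigma\in\mathbb{C}\setminus\{0\}$, where $c=c'=0$ unless $p=-1$. -/

import Mathlib

open Polynomial

namespace LieConformal

/-! ### `λ`-polynomials

For a `ℂ[∂]`-module `M` (with `∂` the variable `X` of `ℂ[X]`), the space `M[λ] = ℂ[λ] ⊗ M` is
`ℕ →₀ M`: the value of `q` at `k` is the coefficient of `λ ^ k`. -/

section Substitution

variable {M : Type*} [AddCommGroup M] [Module ℂ M] [Module ℂ[X] M] [IsScalarTower ℂ ℂ[X] M]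

/-- Substitution `λ ↦ r(∂)` in an element `q = ∑ λ ^ k q_k` of `M[λ]`, giving `∑ r(∂) ^ k q_k`.
For `r = C z` this is the value of `q` at the complex number `z`. An element of `M[λ]` is
determined by its values at all complex numbers, and likewise for `M[λ, μ]`, so that the identities
between polynomials below are written as identities between their values. -/
noncomputable def subst (r : ℂ[X]) : (ℕ →₀ M) →ₗ[ℂ] M :=
  Finsupp.lsum ℂ fun k => Algebra.lsmul ℂ ℂ M (r ^ k)

end Substitution

/-- The sign `(-1) ^ (|a| |b|)` for parities `|a| = α`, `|b| = β`. -/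
def paritySign (α β : ZMod 2) : ℂ := if α = 1 ∧ β = 1 then -1 else 1

/-- A Lie conformal superalgebra structure on a `ℂ[∂]`-module `S`; `bracket a b` is `[a_λ b]`. -/
structure LieConformalSuperalgebra (S : Type*) [AddCommGroup S] [Module ℂ S] [Module ℂ[X] S]
    [IsScalarTower ℂ ℂ[X] S] where
  /-- the even part `part 0` and the odd part `part 1` -/
  part : ZMod 2 → Submodule ℂ[X] S
  isCompl : IsCompl (part 0) (part 1)
  bracket : S →ₗ[ℂ] S →ₗ[ℂ] (ℕ →₀ S)
  bracket_mem : ∀ (α β : ZMod 2), ∀ a ∈ part α, ∀ b ∈ part β, ∀ k, bracket a b k ∈ part (α + β)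
  /-- `[∂a_λ b] = -λ [a_λ b]` -/
  bracket_del_left : ∀ (a b : S) (z : ℂ),
    subst (C z) (bracket ((X : ℂ[X]) • a) b) = -(z • subst (C z) (bracket a b))
  /-- `[a_λ ∂b] = (∂ + λ) [a_λ b]` -/
  bracket_del_right : ∀ (a b : S) (z : ℂ),
    subst (C z) (bracket a ((X : ℂ[X]) • b)) = (X + C z) • subst (C z) (bracket a b)
  /-- `[a_λ b] = -(-1) ^ (|a| |b|) [b_{-λ-∂} a]` -/
  bracket_skew : ∀ (α β : ZMod 2), ∀ a ∈ part α, ∀ b ∈ part β, ∀ z : ℂ,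
    subst (C z) (bracket a b) = -(paritySign α β • subst (-C z - X) (bracket b a))
  /-- `[a_λ [b_μ c]] = [[a_λ b]_{λ+μ} c] + (-1) ^ (|a| |b|) [b_μ [a_λ c]]` -/
  jacobi : ∀ (α β : ZMod 2), ∀ a ∈ part α, ∀ b ∈ part β, ∀ (c : S) (z w : ℂ),
    subst (C z) (bracket a (subst (C w) (bracket b c))) =
      subst (C (z + w)) (bracket (subst (C z) (bracket a b)) c) +
        paritySign α β • subst (C w) (bracket b (subst (C z) (bracket a c)))

/-- A conformal module structure on a `ℂ[∂]`-module `M` over a Lie conformal superalgebra;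
`act a v` is `a_λ v`. -/
structure ConformalModule {S : Type*} [AddCommGroup S] [Module ℂ S] [Module ℂ[X] S]
    [IsScalarTower ℂ ℂ[X] S] (A : LieConformalSuperalgebra S)
    (M : Type*) [AddCommGroup M] [Module ℂ M] [Module ℂ[X] M] [IsScalarTower ℂ ℂ[X] M] where
  /-- the even part `part 0` and the odd part `part 1` -/
  part : ZMod 2 → Submodule ℂ[X] M
  isCompl : IsCompl (part 0) (part 1)
  act : S →ₗ[ℂ] M →ₗ[ℂ] (ℕ →₀ M)
  act_mem : ∀ (α β : ZMod 2), ∀ a ∈ A.part α, ∀ v ∈ part β, ∀ k, act a v k ∈ part (α + β)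
  /-- `(∂a)_λ v = -λ (a_λ v)` -/
  act_del_left : ∀ (a : S) (v : M) (z : ℂ),
    subst (C z) (act ((X : ℂ[X]) • a) v) = -(z • subst (C z) (act a v))
  /-- `a_λ (∂v) = (∂ + λ) (a_λ v)` -/
  act_del_right : ∀ (a : S) (v : M) (z : ℂ),
    subst (C z) (act a ((X : ℂ[X]) • v)) = (X + C z) • subst (C z) (act a v)
  /-- `a_λ (b_μ v) - (-1) ^ (|a| |b|) b_μ (a_λ v) = [a_λ b]_{λ+μ} v` -/
  jacobi : ∀ (α β : ZMod 2), ∀ a ∈ A.part α, ∀ b ∈ A.part β, ∀ (v : M) (z w : ℂ),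
    subst (C z) (act a (subst (C w) (act b v))) -
        paritySign α β • subst (C w) (act b (subst (C z) (act a v))) =
      subst (C (z + w)) (act (subst (C z) (A.bracket a b)) v)

namespace ConformalModule

variable {S : Type*} [AddCommGroup S] [Module ℂ S] [Module ℂ[X] S] [IsScalarTower ℂ ℂ[X] S]
  {A : LieConformalSuperalgebra S}
  {M : Type*} [AddCommGroup M] [Module ℂ M] [Module ℂ[X] M] [IsScalarTower ℂ ℂ[X] M]
  {N : Type*} [AddCommGroup N] [Module ℂ N] [Module ℂ[X] N] [IsScalarTower ℂ ℂ[X] N]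

/-- The parity change `Π(V)`: the same `λ`-action, with the even and odd parts exchanged. -/
def parityChange (V : ConformalModule A M) : ConformalModule A M where
  part i := V.part (i + 1)
  isCompl := V.isCompl.symm
  act := V.act
  act_mem α β a ha v hv k := by
    have := V.act_mem α (β + 1) a ha v hv k
    rwa [← add_assoc] at this
  act_del_left := V.act_del_left
  act_del_right := V.act_del_right
  jacobi := V.jacobi

/-- `V ≅ W`: there is a parity preserving isomorphism of `ℂ[∂]`-modules that commutes with the
`λ`-actions. -/
def Isomorphic (V : ConformalModule A M) (W : ConformalModule A N) : Prop :=
  ∃ e : M ≃ₗ[ℂ[X]] N, (∀ i, ∀ v ∈ V.part i, e v ∈ W.part i) ∧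
    ∀ (a : S) (v : M) (k : ℕ), W.act a (e v) k = e (V.act a v k)

/-- `V` is free over `ℂ[∂]` of rank `m + n`: its even part has rank `m`, its odd part rank `n`. -/
def IsFreeOfRank (V : ConformalModule A M) (m n : ℕ) : Prop :=
  Module.Free ℂ[X] M ∧ Module.rank ℂ[X] (V.part 0) = m ∧ Module.rank ℂ[X] (V.part 1) = n

/-- The superalgebra acts non-trivially on the part of `V` of parity `i`. -/
def ActsNontriviallyOn (V : ConformalModule A M) (i : ZMod 2) : Prop :=
  ∃ a : S, ∃ v ∈ V.part i, V.act a v ≠ 0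

end ConformalModule

/-! ### `λ`-actions between free `ℂ[∂]`-modules

Elements of `ℂ[∂, λ]` are elements of `ℂ[X][X]`: `∂` is the inner, `λ` the outer variable. -/

/-- `∂` in `ℂ[∂, λ]` -/
noncomputable abbrev del : ℂ[X][X] := C X

/-- `λ` in `ℂ[∂, λ]` -/
noncomputable abbrev lam : ℂ[X][X] := X

/-- the constant `c` in `ℂ[∂, λ]` -/
noncomputable abbrev cst (c : ℂ) : ℂ[X][X] := C (C c)

section FreeAction

variable {ι κ : Type*}

/-- `Q(∂, λ) ↦ Q(∂, λ) y` for a basis element `y`. -/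
noncomputable def toLam (y : κ) : ℂ[X][X] →ₗ[ℂ] (ℕ →₀ (κ →₀ ℂ[X])) where
  toFun Q := Finsupp.onFinset Q.support (fun n => Finsupp.single y (Q.coeff n)) (by
    intro n hn
    rw [mem_support_iff]
    rintro h
    exact hn (by simp [h]))
  map_add' Q R := by ext; simp
  map_smul' c Q := by ext n : 1; simp

/-- `f(∂) ↦ f(-λ)` -/
noncomputable def leftFactor : ℂ[X] →ₐ[ℂ] ℂ[X][X] := aeval (-lam)

/-- `g(∂) ↦ g(∂ + λ)` -/
noncomputable def rightFactor : ℂ[X] →ₐ[ℂ] ℂ[X][X] := aeval (del + lam)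

/-- The `λ`-action of the free `ℂ[∂]`-module with basis `ι` on the free `ℂ[∂]`-module with basis `κ`
with `x_λ y = P x y (∂, λ) (t x y)` for basis elements, extended by the rule
`(f(∂) x)_λ (g(∂) y) = f(-λ) g(∂ + λ) (x_λ y)`. -/
noncomputable def freeAct (t : ι → κ → κ) (P : ι → κ → ℂ[X][X]) :
    (ι →₀ ℂ[X]) →ₗ[ℂ] (κ →₀ ℂ[X]) →ₗ[ℂ] (ℕ →₀ (κ →₀ ℂ[X])) :=
  Finsupp.lsum ℂ fun x => LinearMap.flip (Finsupp.lsum ℂ fun y => LinearMap.flip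
    (((LinearMap.mul ℂ ℂ[X][X]).compl₁₂ leftFactor.toLinearMap rightFactor.toLinearMap).compr₂
      (toLam (t x y) ∘ₗ LinearMap.mulRight ℂ (P x y))))

theorem freeAct_single (t : ι → κ → κ) (P : ι → κ → ℂ[X][X]) (x : ι) (y : κ) (f g : ℂ[X]) :
    freeAct t P (Finsupp.single x f) (Finsupp.single y g) =
      toLam (t x y) (leftFactor f * rightFactor g * P x y) := by
  simp [freeAct]

theorem subst_toLam (r : ℂ[X]) (y : κ) (Q : ℂ[X][X]) :
    subst r (toLam y Q) = Finsupp.single y (Q.eval r) := by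
  simp only [subst, toLam, Finsupp.lsum_apply, LinearMap.coe_mk, AddHom.coe_mk]
  rw [Finsupp.onFinset_sum _ (by simp), eval_eq_sum, Polynomial.sum, Finsupp.single_finsetSum]
  refine Finset.sum_congr rfl fun n _ => ?_
  change r ^ n • Finsupp.single y (Q.coeff n) = _
  rw [Finsupp.smul_single, smul_eq_mul, mul_comm]

theorem subst_freeAct (t : ι → κ → κ) (P : ι → κ → ℂ[X][X]) (r : ℂ[X]) (x : ι) (y : κ)
    (f g : ℂ[X]) :
    subst r (freeAct t P (Finsupp.single x f) (Finsupp.single y g)) =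
      Finsupp.single (t x y) (f.comp (-r) * g.comp (X + r) * (P x y).eval r) := by
  have h1 : (leftFactor f).eval r = f.comp (-r) := by
    induction f using Polynomial.induction_on' with
    | add p q hp hq => simp [hp, hq]
    | monomial n a => simp [leftFactor, aeval_monomial, Polynomial.algebraMap_apply]
  have h2 : (rightFactor g).eval r = g.comp (X + r) := by
    induction g using Polynomial.induction_on' with
    | add p q hp hq => simp [hp, hq]
    | monomial n a => simp [rightFactor, aeval_monomial, Polynomial.algebraMap_apply]
  rw [freeAct_single, subst_toLam, eval_mul, eval_mul, h1, h2]


/-- The span over `ℂ[∂]` of the basis elements of parity `α`. -/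
noncomputable def freePart (par : ι → ZMod 2) (α : ZMod 2) : Submodule ℂ[X] (ι →₀ ℂ[X]) :=
  Finsupp.supported ℂ[X] ℂ[X] {x | par x = α}

theorem single_mem_freePart (par : ι → ZMod 2) (x : ι) (f : ℂ[X]) :
    Finsupp.single x f ∈ freePart par (par x) :=
  Finsupp.single_mem_supported ℂ[X] f rfl

theorem freePart_isCompl (par : ι → ZMod 2) : IsCompl (freePart par 0) (freePart par 1) := by
  refine ⟨Finsupp.disjoint_supported_supported ?_, Finsupp.codisjoint_supported_supported ?_⟩
  · rw [Set.disjoint_left]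
    intro x hx hx'
    simp only [Set.mem_ofPred_eq] at hx hx'
    rw [hx] at hx'
    exact absurd hx' (by decide)
  · refine codisjoint_iff.2 (Set.eq_univ_iff_forall.2 fun x => ?_)
    have : ∀ i : ZMod 2, i = 0 ∨ i = 1 := by decide
    exact this (par x)

theorem freePart_induction {par : ι → ZMod 2} {α : ZMod 2} {p : (ι →₀ ℂ[X]) → Prop}
    (h0 : p 0) (hadd : ∀ a b, p a → p b → p (a + b))
    (hs : ∀ x, par x = α → ∀ f, p (Finsupp.single x f)) {a : ι →₀ ℂ[X]}
    (ha : a ∈ freePart par α) : p a := by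
  rw [← Finsupp.sum_single a, Finsupp.sum]
  refine Finset.sum_induction _ p hadd h0 fun x hx => hs x ?_ _
  exact (Finsupp.mem_supported ℂ[X] a).1 ha hx

theorem freeAct_mem (t : ι → κ → κ) (P : ι → κ → ℂ[X][X]) (par : ι → ZMod 2)
    (par' : κ → ZMod 2) (ht : ∀ x y, par' (t x y) = par x + par' y) (α β : ZMod 2)
    (a : ι →₀ ℂ[X]) (ha : a ∈ freePart par α) (v : κ →₀ ℂ[X]) (hv : v ∈ freePart par' β) (k : ℕ) :
    freeAct t P a v k ∈ freePart par' (α + β) := by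
  revert v
  refine freePart_induction (p := fun a => ∀ v ∈ freePart par' β,
    freeAct t P a v k ∈ freePart par' (α + β)) ?_ ?_ ?_ ha
  · intro v _
    simp
  · intro a b iha ihb v hv
    simpa using add_mem (iha v hv) (ihb v hv)
  · intro x hx f v hv
    refine freePart_induction (p := fun v =>
      freeAct t P (Finsupp.single x f) v k ∈ freePart par' (α + β)) ?_ ?_ ?_ hv
    · simp
    · intro a b iha ihb
      simpa using add_mem iha ihb
    · intro y hy g
      rw [freeAct_single, ← hx, ← hy, ← ht]
      exact single_mem_freePart par' _ _

theorem freeAct_del_left (t : ι → κ → κ) (P : ι → κ → ℂ[X][X]) (a : ι →₀ ℂ[X]) (v : κ →₀ ℂ[X])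
    (z : ℂ) : subst (C z) (freeAct t P ((X : ℂ[X]) • a) v) =
      -(z • subst (C z) (freeAct t P a v)) := by
  induction a using Finsupp.induction_linear with
  | zero => simp
  | add a b ha hb => simp only [smul_add, map_add, LinearMap.add_apply, ha, hb, neg_add]
  | single x f =>
    induction v using Finsupp.induction_linear with
    | zero => simp
    | add a b ha hb => simp only [smul_add, map_add, ha, hb, neg_add]
    | single y g =>
      rw [Finsupp.smul_single, subst_freeAct, subst_freeAct, Finsupp.smul_single,
        ← Finsupp.single_neg]
      congr 1
      simp only [smul_eq_mul, mul_comp, X_comp, Polynomial.smul_eq_C_mul]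
      ring

theorem freeAct_del_right (t : ι → κ → κ) (P : ι → κ → ℂ[X][X]) (a : ι →₀ ℂ[X]) (v : κ →₀ ℂ[X])
    (z : ℂ) : subst (C z) (freeAct t P a ((X : ℂ[X]) • v)) =
      (X + C z) • subst (C z) (freeAct t P a v) := by
  induction a using Finsupp.induction_linear with
  | zero => simp
  | add a b ha hb => simp only [smul_add, map_add, LinearMap.add_apply, ha, hb]
  | single x f =>
    induction v using Finsupp.induction_linear with
    | zero => simp
    | add a b ha hb => simp only [smul_add, map_add, ha, hb]
    | single y g =>
      rw [Finsupp.smul_single, subst_freeAct, subst_freeAct, Finsupp.smul_single]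
      congr 1
      simp only [smul_eq_mul, mul_comp, X_comp]
      ring

/-- The module identity for `freeAct` follows from the identity for basis elements. -/
theorem freeAct_jacobi (m : ι → ι → ι) (B : ι → ι → ℂ[X][X]) (t : ι → κ → κ)
    (P : ι → κ → ℂ[X][X]) (par : ι → ZMod 2)
    (h1 : ∀ x x' y, t x (t x' y) = t (m x x') y)
    (h2 : ∀ x x' y, t x' (t x y) = t (m x x') y)
    (h : ∀ x x' y, ∀ z w : ℂ,
      ((P x' y).eval (C w)).comp (X + C z) * (P x (t x' y)).eval (C z) -
        paritySign (par x) (par x') •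
          (((P x y).eval (C z)).comp (X + C w) * (P x' (t x y)).eval (C w)) =
        ((B x x').eval (C z)).comp (-C (z + w)) * (P (m x x') y).eval (C (z + w)))
    (α β : ZMod 2) (a : ι →₀ ℂ[X]) (ha : a ∈ freePart par α) (b : ι →₀ ℂ[X])
    (hb : b ∈ freePart par β) (v : κ →₀ ℂ[X]) (z w : ℂ) :
    subst (C z) (freeAct t P a (subst (C w) (freeAct t P b v))) -
        paritySign α β • subst (C w) (freeAct t P b (subst (C z) (freeAct t P a v))) =
      subst (C (z + w)) (freeAct t P (subst (C z) (freeAct m B a b)) v) := by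
  obtain ⟨s, hs⟩ : ∃ s, s = z + w := ⟨_, rfl⟩
  rw [← hs]
  revert b
  refine freePart_induction (p := fun a => ∀ b ∈ freePart par β,
    subst (C z) (freeAct t P a (subst (C w) (freeAct t P b v))) -
        paritySign α β • subst (C w) (freeAct t P b (subst (C z) (freeAct t P a v))) =
      subst (C s) (freeAct t P (subst (C z) (freeAct m B a b)) v)) ?_ ?_ ?_ ha
  · intro b _
    simp
  · intro a a' iha iha' b hb
    simp only [map_add, LinearMap.add_apply, smul_add]
    rw [add_sub_add_comm, iha b hb, iha' b hb]
  intro x hx f b hb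
  refine freePart_induction (p := fun b =>
    subst (C z) (freeAct t P (Finsupp.single x f) (subst (C w) (freeAct t P b v))) -
        paritySign α β •
          subst (C w) (freeAct t P b (subst (C z) (freeAct t P (Finsupp.single x f) v))) =
      subst (C s) (freeAct t P (subst (C z) (freeAct m B (Finsupp.single x f) b)) v))
    ?_ ?_ ?_ hb
  · simp
  · intro a a' iha iha'
    simp only [map_add, LinearMap.add_apply, smul_add]
    rw [add_sub_add_comm, iha, iha']
  intro x' hx' g
  induction v using Finsupp.induction_linear with
  | zero => simp
  | add a a' iha iha' =>
    simp only [map_add, smul_add]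
    rw [add_sub_add_comm, iha, iha']
  | single y k =>
    simp only [subst_freeAct]
    rw [h1 x x' y, h2 x x' y, Finsupp.smul_single, ← Finsupp.single_sub]
    congr 1
    have := h x x' y z w
    rw [hx, hx', ← hs] at this
    have e1 : ∀ q : ℂ[X], (q.comp (-C w)).comp (X + C z) = q.comp (-C w) := fun q => by
      simp [comp_assoc]
    have e2 : ∀ q : ℂ[X], (q.comp (-C z)).comp (X + C w) = q.comp (-C z) := fun q => by
      simp [comp_assoc]
    have e3 : ∀ q : ℂ[X], (q.comp (X + C w)).comp (X + C z) = q.comp (X + C s) := fun q => by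
      simp [comp_assoc, hs, add_assoc]
    have e4 : ∀ q : ℂ[X], (q.comp (X + C z)).comp (X + C w) = q.comp (X + C s) := fun q => by
      rw [comp_assoc, hs, C_add]
      simp [add_comm, add_left_comm]
    have e5 : ∀ q : ℂ[X], (q.comp (-C z)).comp (-C s) = q.comp (-C z) := fun q => by
      simp [comp_assoc]
    have e6 : ∀ q : ℂ[X], (q.comp (X + C z)).comp (-C s) = q.comp (-C w) := fun q => by
      simp [comp_assoc, hs]
    simp only [mul_comp, e1, e2, e3, e4, e5, e6]
    rw [Polynomial.smul_eq_C_mul] at this ⊢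
    linear_combination (f.comp (-C z) * g.comp (-C w) * k.comp (X + C s)) * this

end FreeAction

/-! ### The Lie conformal superalgebra `𝒮(p)` -/

/-- The three families of generators `L_i`, `W_i`, `G_i`. -/
inductive Kind
  | L | W | G

/-- The generators of `𝒮(p)`: `(Kind.L, i)` is `L_i`, and so on. -/
abbrev Gen := Kind × ℕ

/-- `L_i` and `W_i` are even, `G_i` is odd. -/
def Kind.parity : Kind → ZMod 2
  | .L => 0
  | .W => 0
  | .G => 1

/-- The family in which the bracket of two generators lies
(the values at `W, W` and `G, G` do not matter, as these brackets vanish). -/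
def Kind.target : Kind → Kind → Kind
  | .L, k => k
  | k, .L => k
  | .W, .W => .W
  | .W, .G => .G
  | .G, .W => .G
  | .G, .G => .W

theorem Kind.parity_target (k l : Kind) : (k.target l).parity = k.parity + l.parity := by
  cases k <;> cases l <;> decide

theorem Kind.target_comm (k l : Kind) : k.target l = l.target k := by
  cases k <;> cases l <;> rfl

theorem Kind.target_assoc (k l m : Kind) : (k.target l).target m = k.target (l.target m) := by
  cases k <;> cases l <;> cases m <;> rfl

/-- The bracket of two generators is a multiple of this generator. -/
def Gen.target (x y : Gen) : Gen := (x.1.target y.1, x.2 + y.2)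

/-- The coefficient in `ℂ[∂, λ]` of the bracket of two generators of `𝒮(p)`. -/
noncomputable def bracketCoeff (p : ℂ) : Gen → Gen → ℂ[X][X]
  | (.L, i), (.L, j) => cst (i + p) * del + cst (i + j + 2 * p) * lam
  | (.L, i), (.W, j) => cst (i + p) * del + cst (i + j + p) * lam
  | (.L, i), (.G, j) => cst (i + p) * del + cst (i + j + 2 * p) * lam
  | (.W, _), (.G, _) => 1
  | (.W, _), (.W, _) => 0
  | (.G, _), (.G, _) => 0
  -- the remaining brackets are determined by skew-symmetry
  | (.W, i), (.L, j) => cst i * del + cst (i + j + p) * lam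
  | (.G, i), (.L, j) => cst (i + p) * del + cst (i + j + 2 * p) * lam
  | (.G, _), (.W, _) => -1

theorem bracketCoeff_skew (p : ℂ) (x y : Gen) (z : ℂ) :
    (bracketCoeff p x y).eval (C z) =
      -(C (paritySign x.1.parity y.1.parity) * (bracketCoeff p y x).eval (-C z - X)) := by
  have h2 : (C 2 : ℂ[X]) = 2 := rfl
  obtain ⟨k, i⟩ := x
  obtain ⟨l, j⟩ := y
  cases k <;> cases l <;> simp [bracketCoeff, paritySign, Kind.parity, h2] <;> ring

theorem bracketCoeff_jacobi (p : ℂ) (x x' y : Gen) (z w : ℂ) :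
    ((bracketCoeff p x' y).eval (C w)).comp (X + C z) *
        (bracketCoeff p x (Gen.target x' y)).eval (C z) -
      paritySign x.1.parity x'.1.parity •
        (((bracketCoeff p x y).eval (C z)).comp (X + C w) *
          (bracketCoeff p x' (Gen.target x y)).eval (C w)) =
      ((bracketCoeff p x x').eval (C z)).comp (-C (z + w)) *
        (bracketCoeff p (Gen.target x x') y).eval (C (z + w)) := by
  have h2 : (C 2 : ℂ[X]) = 2 := rfl
  rw [Polynomial.smul_eq_C_mul]
  obtain ⟨k, i⟩ := x
  obtain ⟨l, j⟩ := x'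
  obtain ⟨m, n⟩ := y
  cases k <;> cases l <;> cases m <;>
    simp [Gen.target, Kind.target, bracketCoeff, paritySign, Kind.parity, h2] <;> ring

/-- The Lie conformal superalgebra `𝒮(p)`, the free `ℂ[∂]`-module on `L_i`, `W_i`, `G_i`, `i ≥ 0`. -/
noncomputable def superBlock (p : ℂ) : LieConformalSuperalgebra (Gen →₀ ℂ[X]) where
  part := freePart fun x => x.1.parity
  isCompl := freePart_isCompl _
  bracket := freeAct Gen.target (bracketCoeff p)
  bracket_mem := freeAct_mem _ _ _ _ (fun _ _ => Kind.parity_target _ _)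
  bracket_del_left := freeAct_del_left _ _
  bracket_del_right := freeAct_del_right _ _
  bracket_skew := by
    intro α β a ha b hb z
    revert b
    refine freePart_induction (p := fun a => ∀ b ∈ freePart (fun x : Gen => x.1.parity) β,
      subst (C z) (freeAct Gen.target (bracketCoeff p) a b) =
        -(paritySign α β • subst (-C z - X) (freeAct Gen.target (bracketCoeff p) b a)))
      ?_ ?_ ?_ ha
    · simp
    · intro a a' iha iha' b hb
      simp only [map_add, LinearMap.add_apply, smul_add, iha b hb, iha' b hb, neg_add]
    intro x hx f b hb
    refine freePart_induction (p := fun b =>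
      subst (C z) (freeAct Gen.target (bracketCoeff p) (Finsupp.single x f) b) =
        -(paritySign α β •
          subst (-C z - X) (freeAct Gen.target (bracketCoeff p) b (Finsupp.single x f))))
      ?_ ?_ ?_ hb
    · simp
    · intro a a' iha iha'
      simp only [map_add, LinearMap.add_apply, smul_add, iha, iha', neg_add]
    intro y hy g
    have ht : Gen.target y x = Gen.target x y := by
      simp [Gen.target, Kind.target_comm, add_comm]
    rw [subst_freeAct, subst_freeAct, ht, Finsupp.smul_single, ← Finsupp.single_neg]
    congr 1
    have e1 : X + (-C z - X) = -C z := by ring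
    have e2 : -(-C z - X) = X + C z := by ring
    have key : (bracketCoeff p x y).eval (C z) =
        -(C (paritySign α β) * (bracketCoeff p y x).eval (-C z - X)) := by
      rw [← hx, ← hy]
      exact bracketCoeff_skew p x y z
    rw [e1, e2, key, Polynomial.smul_eq_C_mul]
    ring
  jacobi := by
    intro α β a ha b hb c z w
    rw [← sub_eq_iff_eq_add]
    refine freeAct_jacobi Gen.target (bracketCoeff p) Gen.target (bracketCoeff p)
      (fun x => x.1.parity) ?_ ?_ (bracketCoeff_jacobi p) α β a ha b hb c z w
    · intro x x' y
      simp [Gen.target, Kind.target_assoc, add_assoc]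
    · intro x x' y
      simp [Gen.target, Kind.target_assoc, Kind.target_comm x.1 x'.1, add_left_comm, add_assoc]

/-! ### The modules of rank `1 + 1` -/

/-- The generator of `ℂ[∂] v_0 ⊕ ℂ[∂] v_1` to which `x` maps `v_i`, up to a coefficient. -/
def pairTarget (x : Gen) (i : ZMod 2) : ZMod 2 := x.1.parity + i

/-- The module identity for the generators of `𝒮(p)`, acting on `v_0`, `v_1` by `P`. -/
def PairIdentity (p : ℂ) (P : Gen → ZMod 2 → ℂ[X][X]) : Prop :=
  ∀ (x x' : Gen) (i : ZMod 2) (z w : ℂ),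
      ((P x' i).eval (C w)).comp (X + C z) * (P x (pairTarget x' i)).eval (C z) -
        paritySign x.1.parity x'.1.parity •
          (((P x i).eval (C z)).comp (X + C w) * (P x' (pairTarget x i)).eval (C w)) =
        ((bracketCoeff p x x').eval (C z)).comp (-C (z + w)) *
          (P (x.target x') i).eval (C (z + w))

/-- The conformal `𝒮(p)`-module `ℂ[∂] v_0 ⊕ ℂ[∂] v_1`, `v_i` of parity `i`, on which a generator `x`
acts by `x_λ v_i = P x i (∂, λ) v_{i + |x|}`; `h` is the module identity for generators. -/
noncomputable def pairModule (p : ℂ) (P : Gen → ZMod 2 → ℂ[X][X])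
    (h : PairIdentity p P) :
    ConformalModule (superBlock p) (ZMod 2 →₀ ℂ[X]) where
  part := freePart id
  isCompl := freePart_isCompl _
  act := freeAct pairTarget P
  act_mem := freeAct_mem _ _ _ _ (fun _ _ => rfl)
  act_del_left := freeAct_del_left _ _
  act_del_right := freeAct_del_right _ _
  jacobi := by
    refine freeAct_jacobi Gen.target (bracketCoeff p) pairTarget P (fun x => x.1.parity) ?_ ?_ h
    · intro x x' y
      simp [pairTarget, Gen.target, Kind.parity_target, add_assoc]
    · intro x x' y
      simp [pairTarget, Gen.target, Kind.parity_target, add_left_comm, add_assoc]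

/-- The coefficients of the action of the generators in `V_{a,b,c,d,a',b',c',d'}`. -/
noncomputable def sumCoeff (p a b c d a' b' c' d' : ℂ) : Gen → ZMod 2 → ℂ[X][X]
  | (.L, 0), i => if i = 0 then cst p * (del + cst a * lam + cst b)
      else cst p * (del + cst a' * lam + cst b')
  | (.L, 1), i => if i = 0 then cst c else cst c'
  | (.L, _ + 2), _ => 0
  | (.W, 0), i => if i = 0 then cst d else cst d'
  | (.W, _ + 1), _ => 0
  | (.G, _), _ => 0

/-- The coefficients of the action of the generators in `V_{a,b,c,d,σ}`. -/
noncomputable def constCoeff (p a b c d σ : ℂ) : Gen → ZMod 2 → ℂ[X][X]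
  | (.L, 0), i => if i = 0 then cst p * (del + cst a * lam + cst b)
      else cst p * (del + cst (a + 1) * lam + cst b)
  | (.L, 1), _ => cst c
  | (.L, _ + 2), _ => 0
  | (.W, 0), i => if i = 0 then cst d else cst (d + 1)
  | (.W, _ + 1), _ => 0
  | (.G, 0), i => if i = 0 then cst σ else 0
  | (.G, _ + 1), _ => 0

/-- The coefficients of the action of the generators in `V_{a,b,σ}`. -/
noncomputable def linCoeff (p a b σ : ℂ) : Gen → ZMod 2 → ℂ[X][X]
  | (.L, 0), _ => cst p * (del + cst a * lam + cst b)
  | (.L, _ + 1), _ => 0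
  | (.W, 0), i => if i = 0 then cst (a - 1) else cst a
  | (.W, _ + 1), _ => 0
  | (.G, 0), i => if i = 0 then cst σ * (del + cst a * lam + cst b) else 0
  | (.G, _ + 1), _ => 0

theorem sumCoeff_zero_of_le (p a b c d a' b' c' d' : ℂ) (k : Kind) (m : ℕ) (i : ZMod 2) :
    sumCoeff p a b c d a' b' c' d' (k, m + 2) i = 0 := by
  cases k <;> rfl

theorem sumCoeff_identity (p a b c d a' b' c' d' : ℂ) (h : p ≠ -1 → c = 0 ∧ c' = 0) :
    PairIdentity p (sumCoeff p a b c d a' b' c' d') := by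
  have h2 : (C 2 : ℂ[X]) = 2 := rfl
  have hc : C p * C c = -C c := by
    rw [← C_mul, ← C_neg]
    by_cases hp : p = -1
    · simp [hp]
    · simp [(h hp).1]
  have hc' : C p * C c' = -C c' := by
    rw [← C_mul, ← C_neg]
    by_cases hp : p = -1
    · simp [hp]
    · simp [(h hp).2]
  have hz : ∀ k l m n i, sumCoeff p a b c d a' b' c' d' (Gen.target (k, m + 2) (l, n)) i = 0 := fun k l m n i => by
    rw [← sumCoeff_zero_of_le p a b c d a' b' c' d' (k.target l) (m + n) i]
    simp [Gen.target, add_right_comm]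
  have hz' : ∀ k l m n i, sumCoeff p a b c d a' b' c' d' (Gen.target (k, m) (l, n + 2)) i = 0 := fun k l m n i => by
    rw [← sumCoeff_zero_of_le p a b c d a' b' c' d' (k.target l) (m + n) i]
    simp [Gen.target, add_assoc]
  rintro ⟨k, m⟩ ⟨l, n⟩ i z w
  have hi : i = 0 ∨ i = 1 := by
    revert i
    decide
  rw [Polynomial.smul_eq_C_mul]
  rcases m with _ | _ | m
  rotate_left 2
  · simp [hz, sumCoeff_zero_of_le]
  all_goals
    rcases n with _ | _ | n
    rotate_left 2
    · simp [hz', sumCoeff_zero_of_le]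
  all_goals
    rcases hi with rfl | rfl <;> cases k <;> cases l <;>
    simp [sumCoeff, pairTarget, Gen.target, Kind.target, bracketCoeff, paritySign, Kind.parity, h2] <;>
    first
      | ring1
      | linear_combination (C z) * hc
      | linear_combination -(C z) * hc
      | linear_combination (C w) * hc
      | linear_combination -(C w) * hc
      | linear_combination (C z) * hc'
      | linear_combination -(C z) * hc'
      | linear_combination (C w) * hc'


theorem constCoeff_zero_of_le (p a b c d σ : ℂ) (k : Kind) (m : ℕ) (i : ZMod 2) :
    constCoeff p a b c d σ (k, m + 2) i = 0 := by
  cases k <;> rfl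

theorem constCoeff_identity (p a b c d σ : ℂ) (h : p ≠ -1 → c = 0) :
    PairIdentity p (constCoeff p a b c d σ) := by
  have h2 : (C 2 : ℂ[X]) = 2 := rfl
  have hc : C p * C c = -C c := by
    rw [← C_mul, ← C_neg]
    by_cases hp : p = -1
    · simp [hp]
    · simp [h hp]
  have hz : ∀ k l m n i, constCoeff p a b c d σ (Gen.target (k, m + 2) (l, n)) i = 0 := fun k l m n i => by
    rw [← constCoeff_zero_of_le p a b c d σ (k.target l) (m + n) i]
    simp [Gen.target, add_right_comm]
  have hz' : ∀ k l m n i, constCoeff p a b c d σ (Gen.target (k, m) (l, n + 2)) i = 0 := fun k l m n i => by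
    rw [← constCoeff_zero_of_le p a b c d σ (k.target l) (m + n) i]
    simp [Gen.target, add_assoc]
  rintro ⟨k, m⟩ ⟨l, n⟩ i z w
  have hi : i = 0 ∨ i = 1 := by
    revert i
    decide
  rw [Polynomial.smul_eq_C_mul]
  rcases m with _ | _ | m
  rotate_left 2
  · simp [hz, constCoeff_zero_of_le]
  all_goals
    rcases n with _ | _ | n
    rotate_left 2
    · simp [hz', constCoeff_zero_of_le]
  all_goals
    rcases hi with rfl | rfl <;> cases k <;> cases l <;>
    simp [constCoeff, pairTarget, Gen.target, Kind.target, bracketCoeff, paritySign, Kind.parity, h2] <;>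
    first
      | ring1
      | linear_combination (C z) * hc
      | linear_combination -(C z) * hc
      | linear_combination (C w) * hc


theorem linCoeff_zero_of_le (p a b σ : ℂ) (k : Kind) (m : ℕ) (i : ZMod 2) :
    linCoeff p a b σ (k, m + 2) i = 0 := by
  cases k <;> rfl

theorem linCoeff_identity (p a b σ : ℂ) :
    PairIdentity p (linCoeff p a b σ) := by
  have h2 : (C 2 : ℂ[X]) = 2 := rfl
  have hz : ∀ k l m n i, linCoeff p a b σ (Gen.target (k, m + 2) (l, n)) i = 0 := fun k l m n i => by
    rw [← linCoeff_zero_of_le p a b σ (k.target l) (m + n) i]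
    simp [Gen.target, add_right_comm]
  have hz' : ∀ k l m n i, linCoeff p a b σ (Gen.target (k, m) (l, n + 2)) i = 0 := fun k l m n i => by
    rw [← linCoeff_zero_of_le p a b σ (k.target l) (m + n) i]
    simp [Gen.target, add_assoc]
  rintro ⟨k, m⟩ ⟨l, n⟩ i z w
  have hi : i = 0 ∨ i = 1 := by
    revert i
    decide
  rw [Polynomial.smul_eq_C_mul]
  rcases m with _ | _ | m
  rotate_left 2
  · simp [hz, linCoeff_zero_of_le]
  all_goals
    rcases n with _ | _ | n
    rotate_left 2
    · simp [hz', linCoeff_zero_of_le]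
  all_goals
    rcases hi with rfl | rfl <;> cases k <;> cases l <;>
    simp [linCoeff, pairTarget, Gen.target, Kind.target, bracketCoeff, paritySign, Kind.parity, h2] <;>
    first
      | ring1


/-- `V_{a,b,c,d,a',b',c',d'}`. For `p ≠ -1` this is a conformal module only if `c = c' = 0`. -/
noncomputable def sumModule (p a b c d a' b' c' d' : ℂ) (h : p ≠ -1 → c = 0 ∧ c' = 0) :
    ConformalModule (superBlock p) (ZMod 2 →₀ ℂ[X]) :=
  pairModule p (sumCoeff p a b c d a' b' c' d') (sumCoeff_identity p a b c d a' b' c' d' h)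

/-- `V_{a,b,c,d,σ}`. For `p ≠ -1` this is a conformal module only if `c = 0`. -/
noncomputable def constModule (p a b c d σ : ℂ) (h : p ≠ -1 → c = 0) :
    ConformalModule (superBlock p) (ZMod 2 →₀ ℂ[X]) :=
  pairModule p (constCoeff p a b c d σ) (constCoeff_identity p a b c d σ h)

/-- `V_{a,b,σ}`. -/
noncomputable def linModule (p a b σ : ℂ) :
    ConformalModule (superBlock p) (ZMod 2 →₀ ℂ[X]) :=
  pairModule p (linCoeff p a b σ) (linCoeff_identity p a b σ)

end LieConformal

/-! A homogeneous basis turns the module into a family of polynomials in ℂ[∂, λ], one for each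
generator and basis vector (`IsFreeOfRank.exists_isomorphic_pairModule`), subject to the functional
equations `PairIdentity`. These are solved starting from `L_0`.

`L_0 / p` satisfies the Virasoro relation, so on each basis vector it acts by 0 or by ∂ + aλ + b
(`virasoro_rank_one`). If it acts by 0, so does every generator (`eq_zero_of_L_zero`), which
non-triviality in each parity excludes.

Bracketing with `L_0` makes every other coefficient F, after a translation of ∂, an `IsIntertwiner a
a' n`. Expanded in the parameter z of `L_0`, the first-order term is Euler's identity, so F is
homogeneous of degree n + a - a'; higher orders give recursions along its coefficients. For even
generators a' = a and the degree is n, namely j/p for `W_j` and 1 + j/p for `L_j`. A nonzero F of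
degree N then has a nonzero ∂^N coefficient, which for N > 0 is impossible when the operator
commutes with itself (`eq_zero_of_commute`). This kills `W_j` for j > 0. An `L_j` of degree N ≥ 2
would need `L_{2j}` nonzero, of degree 2N - 1, and the quadratic conditions on a in these two
degrees are incompatible. So a nonzero `L_j` with j > 0 is constant with p = -j, and [L_1, L_{j-1}]
rules out j ≥ 2.

For j > 0, `G_j` comes from [W_j, G_0] and vanishes. The relation [W_0, G_0] = G_0 gives a second
recursion for `G_0`; both together leave only degrees 0 and 1, the constant and the linear family
(`IsIntertwiner.eq_of_innerHasse`). Since `G_0` raises the eigenvalue of `W_0` by 1, it is nonzero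
in at most one direction, and that direction decides whether Π appears. -/

namespace LieConformal

/-! ### Polynomials in ∂ and λ: evaluation and Taylor expansion -/

section Bivariate

theorem eq_zero_of_evalEval {F : ℂ[X][X]} (h : ∀ x w, F.evalEval x w = 0) : F = 0 :=
  Polynomial.eq_zero_of_infinite_isRoot F <| Set.Infinite.mono
    (s := Set.range (C : ℂ → ℂ[X]))
    (by
      rintro _ ⟨w, rfl⟩
      exact Polynomial.funext fun x => by simpa [evalEval] using h x w)
    (Set.infinite_range_of_injective C_injective)

theorem ext_evalEval {F H : ℂ[X][X]} (h : ∀ x w, F.evalEval x w = H.evalEval x w) : F = H :=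
  sub_eq_zero.1 <| eq_zero_of_evalEval fun x w => by simp [h]

/-- The Hasse derivative with respect to the inner variable. -/
noncomputable def innerHasse (s : ℕ) (F : ℂ[X][X]) : ℂ[X][X] :=
  F.sum fun k c => monomial k (hasseDeriv s c)

theorem coeff_innerHasse (s : ℕ) (F : ℂ[X][X]) (k : ℕ) :
    (innerHasse s F).coeff k = hasseDeriv s (F.coeff k) := by
  simp only [innerHasse, Polynomial.sum, finsetSum_coeff, coeff_monomial]
  rw [Finset.sum_ite_eq' F.support k fun k => hasseDeriv s (F.coeff k)]
  split_ifs with h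
  · rfl
  · rw [notMem_support_iff.1 h, map_zero]

/-- Hasse derivatives are used because they are exactly the Taylor coefficients: here of F(x + z, w)
in z, and in `evalEval_hasseDeriv` of F(x, z + w). -/
theorem evalEval_innerHasse (s : ℕ) (F : ℂ[X][X]) (x w : ℂ) :
    (innerHasse s F).evalEval x w = (taylor x (F.eval (C w))).coeff s := by
  rw [taylor_coeff, innerHasse, evalEval, Polynomial.sum, eval_finsetSum]
  conv_rhs => rw [eval_eq_sum (p := F), Polynomial.sum, map_sum]
  congr 1
  refine Finset.sum_congr rfl fun k _ => ?_
  rw [eval_monomial, ← C_pow, mul_comm, ← smul_eq_C_mul, mul_comm, ← smul_eq_C_mul, map_smul]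

theorem evalEval_hasseDeriv (s : ℕ) (F : ℂ[X][X]) (x w : ℂ) :
    (hasseDeriv s F).evalEval x w = (taylor w (F.map (evalRingHom x))).coeff s := by
  have : (hasseDeriv s F).map (evalRingHom x) = hasseDeriv s (F.map (evalRingHom x)) := by
    ext k
    simp [hasseDeriv_coeff]
  rw [taylor_coeff, ← this, map_evalRingHom_eval]

theorem eval_taylor_inner (F : ℂ[X][X]) (x z w : ℂ) :
    (taylor x (F.eval (C w))).eval z = F.evalEval (x + z) w := by
  rw [taylor_eval, add_comm, evalEval]

theorem eval_taylor_outer (F : ℂ[X][X]) (x z w : ℂ) :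
    (taylor w (F.map (evalRingHom x))).eval z = F.evalEval x (z + w) := by
  rw [taylor_eval, map_evalRingHom_eval]

/-! ### Intertwiners between rank one modules -/

/-- The equation satisfied by the coefficient of a primary element acting from a rank one module
of weight `a` to one of weight `a'`. -/
def IsIntertwiner (a a' n : ℂ) (F : ℂ[X][X]) : Prop :=
  ∀ x z w : ℂ, F.evalEval (x + z) w * (x + a' * z) - (x + w + a * z) * F.evalEval x w =
    (n * z - w) * F.evalEval x (z + w)

/-- Coefficient of z^(s+1) λ^k ∂^i in the intertwining equation. The case s = 0 is Euler's identity;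
s = 1 and s = 2 move one or two steps along an antidiagonal of coefficients. -/
theorem IsIntertwiner.coeff_eq {a a' n : ℂ} {F : ℂ[X][X]} (h : IsIntertwiner a a' n F)
    (s k i : ℕ) :
    (F.coeff k).coeff (i + s) * (((i + s).choose (s + 1) : ℕ) + a' * ((i + s).choose s : ℕ)) -
        (if s = 0 then a * (F.coeff k).coeff i else 0) =
      (F.coeff (k + s)).coeff i *
        (n * ((k + s).choose s : ℕ) - ((k + s).choose (s + 1) : ℕ)) := by
  have h1 : innerHasse (s + 1) F * C X + cst a' * innerHasse s F -
      (if s = 0 then cst a * F else 0) =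
      cst n * hasseDeriv s F - X * hasseDeriv (s + 1) F := by
    refine ext_evalEval fun x w => ?_
    set A := taylor x (F.eval (C w)) with hA
    set B := taylor w (F.map (evalRingHom x)) with hB
    have h2 : C x * A + C a' * (A * X) - (C ((x + w) * F.evalEval x w) +
        C (a * F.evalEval x w) * X) = C n * (B * X) - C w * B :=
      Polynomial.funext fun z => by
        have := h x z w
        simp only [hA, hB, eval_sub, eval_add, eval_mul, eval_C, eval_X, eval_taylor_inner,
          eval_taylor_outer]
        linear_combination this
    have h3 := congrArg (fun q => q.coeff (s + 1)) h2
    simp only [coeff_sub, coeff_add, coeff_C_mul, coeff_mul_X, coeff_C_succ, coeff_C] at h3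
    have h4 : (if s = 0 then cst a * F else 0).evalEval x w =
        if s = 0 then a * F.evalEval x w else 0 := by
      split_ifs
      · rw [evalEval_mul, evalEval_CC]
      · exact evalEval_zero x w
    simp only [evalEval_add, evalEval_sub, evalEval_mul, evalEval_innerHasse, h4,
      evalEval_hasseDeriv, evalEval_C, evalEval_X, eval_C, eval_X]
    linear_combination h3
  have h2 := congrArg (fun q => (q.coeff k).coeff i) h1
  have h3 : ((if s = 0 then cst a * F else 0).coeff k).coeff i =
      if s = 0 then a * (F.coeff k).coeff i else 0 := by
    split_ifs <;> simp
  simp only [coeff_sub, coeff_add, h3, coeff_mul_C, coeff_C_mul, coeff_innerHasse,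
    hasseDeriv_coeff] at h2
  have h4 : ((hasseDeriv (s + 1)) (F.coeff k) * X).coeff i =
      ((i + s).choose (s + 1) : ℕ) * (F.coeff k).coeff (i + s) := by
    cases i with
    | zero => simp
    | succ i => rw [coeff_mul_X, hasseDeriv_coeff, show i + (s + 1) = i + 1 + s by omega]
  have h5 : (X * (hasseDeriv (s + 1)) F).coeff k =
      ((k + s).choose (s + 1) : ℕ) * F.coeff (k + s) := by
    cases k with
    | zero => simp
    | succ k => rw [coeff_X_mul, hasseDeriv_coeff, show k + (s + 1) = k + 1 + s by omega]
  rw [h4, h5] at h2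
  simp only [← C_eq_natCast, coeff_C_mul] at h2
  linear_combination h2

theorem evalEval_zero_right (F : ℂ[X][X]) (x : ℂ) : F.evalEval x 0 = (F.coeff 0).eval x := by
  rw [evalEval, C_0, coeff_zero_eq_eval_zero]

theorem evalEval_rightFactor (f : ℂ[X]) (x w : ℂ) :
    (rightFactor f).evalEval x w = f.eval (x + w) := by
  induction f using Polynomial.induction_on' with
  | add p q hp hq => simp [hp, hq]
  | monomial n a => simp [rightFactor, aeval_monomial, Polynomial.algebraMap_apply, evalEval_C]

/-- The substitution `∂ ↦ ∂ - b` in `ℂ[∂, λ]`. -/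
noncomputable def shiftInner (b : ℂ) (F : ℂ[X][X]) : ℂ[X][X] :=
  F.map (compRingHom (X - C b))

theorem evalEval_shiftInner (b : ℂ) (F : ℂ[X][X]) (x w : ℂ) :
    (shiftInner b F).evalEval x w = F.evalEval (x - b) w := by
  induction F using Polynomial.induction_on' with
  | add p q hp hq => simp only [shiftInner, Polynomial.map_add, evalEval_add] at *; rw [hp, hq]
  | monomial n a => 
    rw [shiftInner, map_monomial, evalEval, evalEval, eval_monomial, eval_monomial, eval_mul,
      eval_mul, coe_compRingHom_apply, eval_comp, eval_pow, eval_pow]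
    simp

theorem eq_zero_of_shiftInner {b : ℂ} {F : ℂ[X][X]} (h : shiftInner b F = 0) : F = 0 :=
  eq_zero_of_evalEval fun x w => by
    have := evalEval_shiftInner b F (x + b) w
    rw [h, evalEval_zero, add_sub_cancel_right] at this
    exact this.symm

theorem eq_cst_of_homogeneous {F : ℂ[X][X]} (h : ∀ k i, i + k ≠ 0 → (F.coeff k).coeff i = 0) :
    F = cst ((F.coeff 0).coeff 0) := by
  ext k i
  rcases k with _ | k <;> rcases i with _ | i <;> simp [h, coeff_C]

theorem eq_linear_of_homogeneous {F : ℂ[X][X]}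
    (h : ∀ k i, i + k ≠ 1 → (F.coeff k).coeff i = 0) :
    F = cst ((F.coeff 0).coeff 1) * del + cst ((F.coeff 1).coeff 0) * lam := by
  ext k i
  by_cases hki : i + k = 1
  · obtain ⟨rfl, rfl⟩ | ⟨rfl, rfl⟩ : i = 0 ∧ k = 1 ∨ i = 1 ∧ k = 0 := by omega
    all_goals simp [coeff_C]
  · rw [h k i hki]
    rcases k with _ | _ | k <;> rcases i with _ | _ | i <;> simp_all [coeff_C, coeff_X]

theorem choose_three_cast (m : ℕ) :
    (((m + 2).choose 3 : ℕ) : ℂ) * 6 = (m + 2) * (m + 1) * m := by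
  have h1 : ((m + 1 + 1) * (m + 1).choose 2 : ℂ) = (m + 1 + 1).choose 3 * 3 :=
    mod_cast Nat.add_one_mul_choose_eq (m + 1) 2
  have h2 : ((m + 1) * m.choose 1 : ℂ) = (m + 1).choose 2 * 2 :=
    mod_cast Nat.add_one_mul_choose_eq m 1
  rw [Nat.choose_one_right] at h2
  linear_combination -2 * h1 - (m + 2) * h2

theorem choose_two_cast (m : ℕ) : (((m + 1).choose 2 : ℕ) : ℂ) * 2 = (m + 1) * m := by
  have h2 : ((m + 1) * m.choose 1 : ℂ) = (m + 1).choose 2 * 2 :=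
    mod_cast Nat.add_one_mul_choose_eq m 1
  rw [Nat.choose_one_right] at h2
  exact h2.symm

/-- Euler's identity (s = 0 in `coeff_eq`) fixes i + k for every nonzero coefficient of λ^k ∂^i. -/
theorem IsIntertwiner.exists_degree {a a' n : ℂ} {F : ℂ[X][X]} (h : IsIntertwiner a a' n F)
    (hF : F ≠ 0) :
    ∃ N : ℕ, n + a - a' = N ∧ ∀ k i, i + k ≠ N → (F.coeff k).coeff i = 0 := by
  have key : ∀ k i, (F.coeff k).coeff i ≠ 0 → n + a - a' = ((i + k : ℕ) : ℂ) := fun k i hc => by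
    have := h.coeff_eq 0 k i
    simp only [add_zero, zero_add, Nat.choose_one_right, Nat.choose_zero_right, if_true] at this
    apply mul_left_cancel₀ hc
    push_cast at this ⊢
    linear_combination -this
  obtain ⟨k, hk⟩ : ∃ k, F.coeff k ≠ 0 := by
    by_contra! hc
    exact hF (Polynomial.ext hc)
  obtain ⟨i, hi⟩ : ∃ i, (F.coeff k).coeff i ≠ 0 := by
    by_contra! hc
    exact hk (Polynomial.ext hc)
  refine ⟨i + k, key k i hi, fun k' i' hne => ?_⟩
  by_contra hc
  have := (key k i hi).symm.trans (key k' i' hc)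
  exact hne (mod_cast this.symm)

theorem eq_zero_of_homogeneous {F : ℂ[X][X]} {N : ℕ}
    (h : ∀ k i, i + k ≠ N → (F.coeff k).coeff i = 0) (h0 : (F.coeff 0).coeff N = 0)
    (hs : ∀ k i, i + 1 + k = N → (F.coeff k).coeff (i + 1) = 0 → (F.coeff (k + 1)).coeff i = 0) :
    F = 0 := by
  have key : ∀ k i, i + k = N → (F.coeff k).coeff i = 0 := by
    intro k
    induction k with
    | zero => rintro i rfl; exact h0
    | succ k ih => exact fun i hi => hs k i (by omega) (ih (i + 1) (by omega))
  ext k i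
  rw [coeff_zero, coeff_zero]
  by_cases hki : i + k = N
  · exact key k i hki
  · exact h k i hki

/-- The s = 1 recursion determines all coefficients from that of ∂^N. From N = 2 on, the coefficient
of λ^2 ∂^(N-2) is reached both by two steps s = 1 and by one step s = 2; their agreement is the
quadratic condition on a. -/
theorem IsIntertwiner.exists_degree_of_eq {a n : ℂ} {F : ℂ[X][X]} (h : IsIntertwiner a a n F)
    (hF : F ≠ 0) :
    ∃ N : ℕ, n = N ∧ (∀ k i, i + k ≠ N → (F.coeff k).coeff i = 0) ∧ (F.coeff 0).coeff N ≠ 0 ∧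
      (2 ≤ N → 12 * a * (a - 1) = (N - 2) * (N + 1)) := by
  obtain ⟨N, hN, hom⟩ := h.exists_degree hF
  rw [add_sub_cancel_right] at hN
  have top : (F.coeff 0).coeff N ≠ 0 := fun h0 => hF <| eq_zero_of_homogeneous hom h0 <| by
    intro k i hi hc
    have := h.coeff_eq 1 k i
    rw [hc, if_neg one_ne_zero, zero_mul, sub_zero] at this
    refine (mul_eq_zero.1 this.symm).resolve_right fun h1 => ?_
    have h2 := choose_two_cast k
    rw [Nat.choose_one_right, hN, ← hi] at h1
    push_cast at h1
    -- With n = N = i + 1 + k, this is twice the factor multiplying the next coefficient, so the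
    -- recursion never degenerates.
    have h3 : ((k : ℂ) + 1) * (2 * i + 2 + k) = 0 := by linear_combination 2 * h1 + h2
    norm_cast at h3
    simp at h3
  refine ⟨N, hN, hom, top, fun h2 => ?_⟩
  obtain ⟨m, rfl⟩ := Nat.exists_eq_add_of_le' h2
  have e1 := h.coeff_eq 1 0 (m + 1)
  have e2 := h.coeff_eq 1 1 m
  have e3 := h.coeff_eq 2 0 m
  have c2 := choose_two_cast (m + 1)
  have c2' := choose_two_cast m
  have c3 := choose_three_cast m
  rw [hN] at e1 e2 e3
  simp only [Nat.choose_one_right, Nat.reduceAdd, Nat.choose_self, add_assoc, zero_add,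
    one_ne_zero, OfNat.ofNat_ne_zero, if_false, sub_zero, Nat.choose_succ_self] at e1 e2 e3 c2 c2' c3
  push_cast at *
  have hm : ((m : ℂ) + 2) * (m + 1) ≠ 0 := by
    norm_cast
  apply mul_left_cancel₀ top
  apply mul_left_cancel₀ hm
  linear_combination (6 * (m + 1) * (m + 2 * a)) * (e1 - (F.coeff 0).coeff (m + 2) / 2 * c2) +
    12 * (m + 2) * (e2 - (F.coeff 1).coeff (m + 1) / 2 * c2') -
    12 * (2 * m + 3) * (e3 - (F.coeff 0).coeff (m + 2) / 6 * c3 -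
      (F.coeff 0).coeff (m + 2) * a / 2 * c2)

/-- An operator whose `λ`-action commutes with itself is constant at `λ = 0`. -/
theorem eq_zero_or_coeff_zero_eq_C {F : ℂ[X][X]}
    (h : ∀ x z w : ℂ, F.evalEval (x + z) w * F.evalEval x z =
      F.evalEval (x + w) z * F.evalEval x w) :
    F = 0 ∨ ∃ c, F.coeff 0 = C c := by
  -- At z = 0 the relation says that F, if nonzero, forces F(∂, 0) to be invariant under ∂ ↦ ∂ + λ.
  have h1 : F * (C (F.coeff 0) - rightFactor (F.coeff 0)) = 0 :=
    eq_zero_of_evalEval fun x w => by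
      have := h x 0 w
      rw [add_zero, evalEval_zero_right, evalEval_zero_right] at this
      rw [evalEval_mul, evalEval_sub, evalEval_C, evalEval_rightFactor]
      linear_combination this
  refine (mul_eq_zero.1 h1).imp_right fun h2 => ⟨(F.coeff 0).eval 0, Polynomial.funext fun w => ?_⟩
  have := congrArg (evalEval 0 w) h2
  rw [evalEval_sub, evalEval_C, evalEval_rightFactor, zero_add, evalEval_zero] at this
  rw [eval_C]
  linear_combination -this

theorem IsIntertwiner.eq_zero_of_commute {a : ℂ} {N : ℕ} (hN : N ≠ 0) {F : ℂ[X][X]}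
    (h : IsIntertwiner a a N F)
    (hc : ∀ x z w : ℂ, F.evalEval (x + z) w * F.evalEval x z =
      F.evalEval (x + w) z * F.evalEval x w) : F = 0 := by
  refine (eq_zero_or_coeff_zero_eq_C hc).elim id fun ⟨c, hF⟩ => ?_
  by_contra h0
  obtain ⟨N', hNN', -, top, -⟩ := h.exists_degree_of_eq h0
  obtain rfl : N = N' := mod_cast hNN'
  rw [hF, coeff_C_of_ne_zero hN] at top
  exact top rfl

/-! ### Virasoro modules of rank one, and the odd intertwiners -/

/-- The rank one modules over the Virasoro Lie conformal algebra. -/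
theorem virasoro_rank_one {f : ℂ[X][X]}
    (h : ∀ x z w : ℂ, f.evalEval (x + z) w * f.evalEval x z -
      f.evalEval (x + w) z * f.evalEval x w = (z - w) * f.evalEval x (z + w)) :
    f = 0 ∨ ∃ a b, f = del + cst a * lam + cst b := by
  refine or_iff_not_imp_left.2 fun hf => ?_
  -- The value at z = 0; cancelling f gives f(∂, 0) = ∂ + b, and b is then removed by translating ∂.
  have h1 : f * (C (f.coeff 0) - rightFactor (f.coeff 0) + X) = 0 :=
    eq_zero_of_evalEval fun x w => by
      have := h x 0 w
      rw [add_zero, evalEval_zero_right, evalEval_zero_right, zero_add] at this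
      rw [evalEval_mul, evalEval_add, evalEval_sub, evalEval_C, evalEval_rightFactor, evalEval_X]
      linear_combination this
  obtain ⟨b, hb⟩ : ∃ b, b = (f.coeff 0).eval 0 := ⟨_, rfl⟩
  have hf0 : ∀ x, (f.coeff 0).eval x = x + b := fun x => by
    have := congrArg (evalEval 0 x) ((mul_eq_zero.1 h1).resolve_left hf)
    rw [evalEval_add, evalEval_sub, evalEval_C, evalEval_rightFactor, evalEval_X, zero_add,
      evalEval_zero, ← hb] at this
    linear_combination -this
  set g := shiftInner b f with hg
  have hgf : ∀ x w, g.evalEval x w = f.evalEval (x - b) w := evalEval_shiftInner b f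
  have hg0 : ∀ x, (g.coeff 0).eval x = x := fun x => by
    rw [← evalEval_zero_right, hgf, evalEval_zero_right, hf0, sub_add_cancel]
  have hgne : g ≠ 0 := fun h0 => hf (eq_zero_of_shiftInner h0)
  set φ := g.coeff 1 with hφ
  set q : ℂ[X][X] := 1 + rightFactor φ - C φ with hq
  -- The coefficient of z: the Euler operator multiplies g by q = 1 + φ(∂ + λ) - φ(∂).
  have h2 : innerHasse 1 g * C X + X * derivative g = g * q := by
    refine ext_evalEval fun x w => ?_
    set A := taylor x (g.eval (C w)) with hA
    set B := taylor w (g.map (evalRingHom x)) with hB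
    have h3 : A * g.map (evalRingHom x) - C (g.evalEval x w) * g.map (evalRingHom (x + w)) =
        B * X - C w * B :=
      Polynomial.funext fun z => by
        have := h (x - b) z w
        simp only [sub_add_eq_add_sub, ← hgf] at this
        simp only [hA, hB, eval_sub, eval_mul, eval_C, eval_X, eval_taylor_inner,
          eval_taylor_outer, map_evalRingHom_eval]
        linear_combination this
    have h4 := congrArg (fun q => q.coeff 1) h3
    simp only [coeff_sub, mul_coeff_one, coeff_map, coe_evalRingHom,
      hg0, ← hφ, coeff_X_one, coeff_X_zero, coeff_C_zero, coeff_C_of_ne_zero one_ne_zero] at h4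
    have hA0 : A.coeff 0 = g.evalEval x w := taylor_coeff_zero _ _
    have hB0 : B.coeff 0 = g.evalEval x w := by
      rw [hB, taylor_coeff_zero, map_evalRingHom_eval]
    rw [hA0, hB0] at h4
    rw [hq, ← hasseDeriv_one']
    simp only [evalEval_add, evalEval_sub, evalEval_mul, evalEval_innerHasse, evalEval_one,
      evalEval_hasseDeriv, evalEval_C, evalEval_X, evalEval_rightFactor, eval_X]
    linear_combination h4
  -- The Euler operator does not raise the λ-degree, so q is free of λ, and at λ = 0 it equals 1.
  -- Hence g is homogeneous of degree 1.
  have h3 : q = 1 := by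
    have hq0 : q ≠ 0 := fun h0 => by
      have := congrArg (evalEval 0 0) h0
      simp [hq, evalEval_rightFactor, evalEval_C] at this
    have hd : (g * q).natDegree ≤ g.natDegree := by
      rw [← h2, natDegree_le_iff_coeff_eq_zero]
      intro k hk
      have h5 : g.coeff k = 0 := coeff_eq_zero_of_natDegree_lt hk
      cases k with
      | zero => simp [coeff_innerHasse, h5]
      | succ k => simp [coeff_innerHasse, h5, coeff_X_mul, coeff_derivative]
    rw [natDegree_mul hgne hq0] at hd
    rw [eq_C_of_natDegree_eq_zero (show q.natDegree = 0 by omega)]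
    refine congrArg C (Polynomial.funext fun x => ?_)
    rw [← evalEval_zero_right, hq]
    simp [evalEval_rightFactor, evalEval_C]
  rw [h3, mul_one] at h2
  have hom : ∀ k i, i + k ≠ 1 → (g.coeff k).coeff i = 0 := fun k i hki => by
    have h4 := congrArg (fun q => (q.coeff k).coeff i) h2
    have h5 : (innerHasse 1 g * C X).coeff k = X * derivative (g.coeff k) := by
      rw [coeff_mul_C, coeff_innerHasse, hasseDeriv_one', mul_comm]
    have h6 : (X * derivative (g.coeff k)).coeff i = i * (g.coeff k).coeff i := by
      cases i <;> simp [coeff_X_mul, coeff_derivative, mul_comm]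
    have h7 : ((X * derivative g).coeff k).coeff i = k * (g.coeff k).coeff i := by
      cases k with
      | zero => simp
      | succ k =>
        rw [coeff_X_mul, coeff_derivative, ← Nat.cast_add_one, ← C_eq_natCast, coeff_mul_C,
          mul_comm]
    simp only [coeff_add, h5, h6, h7] at h4
    have h8 : ((i + k : ℕ) - 1 : ℂ) * (g.coeff k).coeff i = 0 := by
      push_cast
      linear_combination h4
    exact (mul_eq_zero.1 h8).resolve_left (sub_ne_zero.2 (mod_cast hki))
  have h4 := eq_linear_of_homogeneous hom
  have h5 : (g.coeff 0).coeff 1 = 1 := by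
    rw [show g.coeff 0 = X from Polynomial.funext fun x => by rw [hg0, eval_X], coeff_X_one]
  refine ⟨(g.coeff 1).coeff 0, b, ext_evalEval fun x w => ?_⟩
  have h6 := hgf (x + b) w
  rw [add_sub_cancel_right] at h6
  rw [← h6, h4, h5]
  simp [evalEval_C]
  ring

/-- The action of `G_0` from weight `a` to weight `a'` is constant or `∂ + a λ` up to a scalar; `d` is
the eigenvalue of `W_0` on the target. -/
theorem IsIntertwiner.eq_of_innerHasse {a a' d : ℂ} {g : ℂ[X][X]} (h : IsIntertwiner a a' 1 g)
    (hg : g ≠ 0)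
    (hd : ∀ x z w : ℂ, d * g.evalEval (x + z) w - (d - 1) * g.evalEval x w =
      g.evalEval x (z + w)) :
    ∃ σ, σ ≠ 0 ∧ ((a' = a + 1 ∧ g = cst σ) ∨
      (a' = a ∧ d = a ∧ g = cst σ * (del + cst a * lam))) := by
  obtain ⟨N, hN, hom⟩ := h.exists_degree hg
  have hs : ∀ s k i, d * (((i + (s + 1)).choose (s + 1) : ℕ) * (g.coeff k).coeff (i + (s + 1))) =
      ((k + (s + 1)).choose (s + 1) : ℕ) * (g.coeff (k + (s + 1))).coeff i := by
    intro s k i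
    -- The coefficient of z^(s+1) in the `W_0` relation; the term with d - 1 is constant in z and
    -- drops out.
    have h1 : cst d * innerHasse (s + 1) g = hasseDeriv (s + 1) g := by
      refine ext_evalEval fun x w => ?_
      have h2 : C d * taylor x (g.eval (C w)) - C ((d - 1) * g.evalEval x w) =
          taylor w (g.map (evalRingHom x)) :=
        Polynomial.funext fun z => by
          simpa only [eval_sub, eval_mul, eval_C, eval_X, eval_taylor_inner,
            eval_taylor_outer] using hd x z w
      have h3 := congrArg (fun q => q.coeff (s + 1)) h2
      simp only [coeff_sub, coeff_C_mul, coeff_C_succ, sub_zero] at h3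
      rw [evalEval_mul, evalEval_CC, evalEval_innerHasse, evalEval_hasseDeriv, h3]
    have h2 := congrArg (fun q => (q.coeff k).coeff i) h1
    simp only [coeff_C_mul, coeff_innerHasse, hasseDeriv_coeff, ← C_eq_natCast] at h2
    exact h2
  have top : (g.coeff 0).coeff N ≠ 0 := fun h0 => hg <| eq_zero_of_homogeneous hom h0 <| by
    intro k i hi hc
    have := hs 0 k i
    rw [zero_add, hc, mul_zero, mul_zero, Nat.choose_one_right] at this
    exact (mul_eq_zero.1 this.symm).resolve_left (Nat.cast_ne_zero.2 k.succ_ne_zero)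
  refine ⟨_, top, ?_⟩
  rcases N with _ | _ | m
  · left
    refine ⟨?_, eq_cst_of_homogeneous hom⟩
    push_cast at hN
    linear_combination -hN
  · right
    push_cast at hN
    have e1 := h.coeff_eq 1 0 0
    have e2 := hs 0 0 0
    simp at e1 e2
    have ha : a' = a := by linear_combination -hN
    have hda : d = a := by
      apply mul_left_cancel₀ top
      rw [zero_add, ← ha]
      linear_combination e2 - e1
    refine ⟨ha, hda, ?_⟩
    rw [eq_linear_of_homogeneous hom, ← e2, hda]
    simp only [zero_add, cst, C_mul, coeff_add, coeff_mul_C]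
    simp [coeff_X, coeff_C]
    ring
  -- In degree m + 2, comparing the two recursions for s = 1 gives d - a' = (m + 1)/2, and for s = 2
  -- gives d - a' = m/3. Equality would mean m = -3.
  · exfalso
    have e1 := h.coeff_eq 1 0 (m + 1)
    have e3 := h.coeff_eq 2 0 m
    have e1' := hs 0 0 (m + 1)
    have e3' := hs 1 0 m
    have c2 := choose_two_cast (m + 1)
    have c3 := choose_three_cast m
    simp only [Nat.choose_one_right, Nat.reduceAdd, Nat.choose_self, add_assoc, zero_add,
      one_ne_zero, OfNat.ofNat_ne_zero, if_false, sub_zero, Nat.choose_succ_self]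
      at e1 e3 e1' e3' c2 c3 top
    push_cast at e1 e3 e1' e3' c2 c3
    have hm : ((m : ℂ) + 2) * (m + 1) ≠ 0 := by
      norm_cast
    have hm' : ((m : ℂ) + 3) ≠ 0 := by
      norm_cast
    apply mul_ne_zero (mul_ne_zero top hm) hm'
    set c := (g.coeff 0).coeff (m + 2)
    linear_combination 6 * (m + 1) * (e1 - e1' - c / 2 * c2) -
      12 * (e3 - e3' - c / 6 * c3 - c * (a' - d) / 2 * c2)

end Bivariate

theorem shiftInner_injective (b : ℂ) : Function.Injective (shiftInner b) := fun F H h =>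
  ext_evalEval fun x w => by
    have := congrArg (evalEval (x + b) w) h
    rwa [evalEval_shiftInner, evalEval_shiftInner, add_sub_cancel_right] at this

theorem shiftInner_cst (b c : ℂ) : shiftInner b (cst c) = cst c := by
  simp [shiftInner]

theorem evalEval_cst (c x w : ℂ) : (cst c).evalEval x w = c := evalEval_CC x w c

theorem evalEval_del (x w : ℂ) : del.evalEval x w = x := by
  rw [del, evalEval_C, eval_X]

theorem cst_zero : cst 0 = 0 := by
  rw [cst, C_0, C_0]

/-- `[L_0 λ x] = p (∂ + (weight + 1 + j / p) λ) x` for a generator `x` of this kind and index `j`,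
so that `1 + weight` is the conformal weight for `j = 0`. -/
noncomputable def Kind.weight : Kind → ℂ
  | .L => 1
  | .W => 0
  | .G => 1

theorem pairTarget_even {k : Kind} (hk : k.parity = 0) (j : ℕ) (i : ZMod 2) :
    pairTarget (k, j) i = i := by
  rw [pairTarget, hk, zero_add]

theorem pairTarget_odd (j : ℕ) (i : ZMod 2) : pairTarget (.G, j) i = i + 1 := add_comm _ _

/-! ### Action of the generators on a homogeneous basis -/

namespace PairIdentity

variable {p : ℂ} {P : Gen → ZMod 2 → ℂ[X][X]}

theorem evalEval_eq (h : PairIdentity p P) (x x' : Gen) (i : ZMod 2) (t z w : ℂ) :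
    (P x' i).evalEval (t + z) w * (P x (pairTarget x' i)).evalEval t z -
        paritySign x.1.parity x'.1.parity *
          ((P x i).evalEval (t + w) z * (P x' (pairTarget x i)).evalEval t w) =
      (bracketCoeff p x x').evalEval (-(z + w)) z * (P (x.target x') i).evalEval t (z + w) := by
  simpa [evalEval] using congrArg (eval t) (h x x' i z w)

theorem even_left (h : PairIdentity p P) {k : Kind} (hk : k.parity = 0) (j : ℕ) (x : Gen)
    (i : ZMod 2) (t z w : ℂ) :
    (P x i).evalEval (t + z) w * (P (k, j) (pairTarget x i)).evalEval t z -
        (P (k, j) i).evalEval (t + w) z * (P x i).evalEval t w =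
      (bracketCoeff p (k, j) x).evalEval (-(z + w)) z *
        (P (k.target x.1, j + x.2) i).evalEval t (z + w) := by
  have := h.evalEval_eq (k, j) x i t z w
  rwa [pairTarget_even hk, paritySign, if_neg (by simp [hk]), one_mul] at this

/-- Since [L_0 λ L_0] = p(∂ + 2λ)L_0, division by p normalises the relation to that of
`virasoro_rank_one`. -/
theorem virasoro (h : PairIdentity p P) (hp : p ≠ 0) (i : ZMod 2) :
    P (.L, 0) i = 0 ∨ ∃ a b, P (.L, 0) i = cst p * (del + cst a * lam + cst b) := by
  have h1 : P (.L, 0) i = cst p * (cst p⁻¹ * P (.L, 0) i) := by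
    rw [← mul_assoc, ← C_mul, ← C_mul, mul_inv_cancel₀ hp, C_1, C_1, one_mul]
  rw [h1]
  refine (virasoro_rank_one (f := cst p⁻¹ * P (.L, 0) i) fun t z w => ?_).imp
    (fun h0 => by rw [h0, mul_zero]) fun ⟨a, b, hab⟩ => ⟨a, b, by rw [hab]⟩
  have h2 := h.even_left (k := .L) rfl 0 (.L, 0) i t z w
  rw [pairTarget_even rfl] at h2
  simp only [bracketCoeff, evalEval_add, evalEval_mul, evalEval_C, evalEval_X,
    eval_X, eval_C, Kind.target, Nat.cast_zero, zero_add] at h2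
  simp only [evalEval_mul, evalEval_cst]
  have h3 : p⁻¹ * p = 1 := inv_mul_cancel₀ hp
  linear_combination p⁻¹ * p⁻¹ * h2 +
    (p⁻¹ * (z - w) * (P (.L, 0) i).evalEval t (z + w)) * h3

theorem bracketCoeff_L_zero (hp : p ≠ 0) (x : Gen) (z w : ℂ) :
    (bracketCoeff p (.L, 0) x).evalEval (-(z + w)) z =
      p * ((x.1.weight + x.2 / p) * z - w) := by
  obtain ⟨k, j⟩ := x
  cases k <;> simp [bracketCoeff, evalEval_C, Kind.weight] <;> field_simp <;> ring

theorem target_L_zero (x : Gen) : ((Kind.L.target x.1, 0 + x.2) : Gen) = x := by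
  rw [zero_add]
  rfl

/-- The bracket with `L_0`, whose own parameter is set to 0. A nonzero coefficient can be cancelled,
leaving a relation between the actions of `L_0` on source and target. -/
theorem L_zero_eq (h : PairIdentity p P) (hp : p ≠ 0) (x : Gen) (i : ZMod 2) :
    P x i * (C ((P (.L, 0) (pairTarget x i)).coeff 0) - rightFactor ((P (.L, 0) i).coeff 0) +
      cst p * lam) = 0 :=
  eq_zero_of_evalEval fun t w => by
    have := h.even_left (k := .L) rfl 0 x i t 0 w
    rw [bracketCoeff_L_zero hp, target_L_zero, evalEval_zero_right, evalEval_zero_right,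
      add_zero] at this
    simp only [evalEval_mul, evalEval_add, evalEval_sub, evalEval_C, evalEval_rightFactor,
      evalEval_X, eval_C]
    rw [zero_add] at this
    linear_combination this

theorem eq_zero_of_L_zero (h : PairIdentity p P) (hp : p ≠ 0) {i : ZMod 2}
    (h0 : P (.L, 0) i = 0) (x : Gen) : P x i = 0 := by
  refine (mul_eq_zero.1 (h.L_zero_eq hp x i)).resolve_right fun h1 => hp ?_
  have key : ∀ w, (C ((P (.L, 0) (pairTarget x i)).coeff 0) -
      rightFactor ((P (.L, 0) i).coeff 0) + cst p * lam).evalEval 0 w = 0 := fun w => by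
    rw [h1, evalEval_zero]
  have k0 := key 0
  have k1 := key 1
  simp only [h0, evalEval_mul, evalEval_add, evalEval_sub, evalEval_C, coeff_zero, map_zero,
    evalEval_zero, eval_C, evalEval_X] at k0 k1
  linear_combination k1 - k0

theorem isIntertwiner (h : PairIdentity p P) (hp : p ≠ 0) (x : Gen) {i : ZMod 2} {a b a' : ℂ}
    (hi : P (.L, 0) i = cst p * (del + cst a * lam + cst b))
    (hi' : P (.L, 0) (pairTarget x i) = cst p * (del + cst a' * lam + cst b)) :
    IsIntertwiner a a' (x.1.weight + x.2 / p) (shiftInner b (P x i)) := by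
  intro t z w
  have := h.even_left (k := .L) rfl 0 x i (t - b) z w
  rw [bracketCoeff_L_zero hp, target_L_zero, hi, hi'] at this
  simp only [evalEval_mul, evalEval_add, evalEval_cst, evalEval_del, evalEval_X] at this
  simp only [evalEval_shiftInner, ← sub_add_eq_add_sub]
  apply mul_left_cancel₀ hp
  linear_combination this

variable {i : ZMod 2} {a b : ℂ}

theorem W_zero (h : PairIdentity p P) (hp : p ≠ 0)
    (hi : P (.L, 0) i = cst p * (del + cst a * lam + cst b)) : ∃ d, P (.W, 0) i = cst d := by
  have h1 := h.isIntertwiner hp (.W, 0) hi (by rw [pairTarget_even rfl, hi])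
  simp only [Kind.weight, Nat.cast_zero, zero_div, add_zero] at h1
  by_cases h0 : shiftInner b (P (.W, 0) i) = 0
  · exact ⟨0, by rw [cst_zero, eq_zero_of_shiftInner h0]⟩
  obtain ⟨N, hN, hom, -⟩ := h1.exists_degree_of_eq h0
  obtain rfl : N = 0 := mod_cast hN.symm
  exact ⟨_, shiftInner_injective b ((eq_cst_of_homogeneous hom).trans (shiftInner_cst b _).symm)⟩

/-- The degree would be (j + 1)/p, which is nonzero, while [W_{j+1} λ W_{j+1}] = 0 makes the
operator commute with itself. -/
theorem W_succ (h : PairIdentity p P) (hp : p ≠ 0)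
    (hi : P (.L, 0) i = cst p * (del + cst a * lam + cst b)) (j : ℕ) : P (.W, j + 1) i = 0 := by
  have h1 := h.isIntertwiner hp (.W, j + 1) hi (by rw [pairTarget_even rfl, hi])
  simp only [Kind.weight, zero_add] at h1
  by_contra hne
  have h0 : shiftInner b (P (.W, j + 1) i) ≠ 0 := fun h0 => hne (eq_zero_of_shiftInner h0)
  obtain ⟨N, hN, -⟩ := h1.exists_degree_of_eq h0
  have hN0 : N ≠ 0 := by
    rintro rfl
    exact (div_eq_zero_iff.1 (hN.trans Nat.cast_zero)).elim (Nat.cast_ne_zero.2 j.succ_ne_zero) hp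
  rw [hN] at h1
  refine h0 (h1.eq_zero_of_commute hN0 fun t z w => ?_)
  have h2 := h.even_left (k := .W) rfl (j + 1) (.W, j + 1) i (t - b) z w
  simp only [pairTarget_even (k := .W) rfl, bracketCoeff, evalEval_zero, zero_mul] at h2
  simp only [evalEval_shiftInner, ← sub_add_eq_add_sub]
  linear_combination h2

/-- The degree is N = 1 + j/p. N = 0 is the conclusion and N = 1 would force j = 0. For N ≥ 2 the
operator cannot commute with itself, so `L_{2j}` acts nontrivially, in degree 2N - 1. -/
theorem L_of_ne_zero (h : PairIdentity p P) (hp : p ≠ 0)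
    (hi : P (.L, 0) i = cst p * (del + cst a * lam + cst b)) {j : ℕ} (hj : j ≠ 0)
    (hne : P (.L, j) i ≠ 0) : p = -j ∧ ∃ c, P (.L, j) i = cst c := by
  have hj' : (j : ℂ) ≠ 0 := Nat.cast_ne_zero.2 hj
  have h1 : ∀ l, IsIntertwiner a a (1 + (l : ℕ) / p) (shiftInner b (P (.L, l) i)) := fun l =>
    h.isIntertwiner hp (.L, l) hi (by rw [pairTarget_even rfl, hi])
  have h0 : shiftInner b (P (.L, j) i) ≠ 0 := fun h0 => hne (eq_zero_of_shiftInner h0)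
  obtain ⟨N, hN, hom, top, hq⟩ := (h1 j).exists_degree_of_eq h0
  rcases N with _ | _ | m
  · refine ⟨?_, _, shiftInner_injective b
      ((eq_cst_of_homogeneous hom).trans (shiftInner_cst b _).symm)⟩
    field_simp at hN
    push_cast at hN
    linear_combination hN
  · simp [hj', hp] at hN
  · exfalso
    have h2 : shiftInner b (P (.L, j + j) i) ≠ 0 := fun h2 => by
      have h3 := h1 j
      rw [hN] at h3
      refine h0 (h3.eq_zero_of_commute (Nat.succ_ne_zero _) fun t z w => ?_)
      have h4 := h.even_left (k := .L) rfl j (.L, j) i (t - b) z w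
      simp only [pairTarget_even (k := .L) rfl, Kind.target, eq_zero_of_shiftInner h2,
        evalEval_zero, mul_zero] at h4
      simp only [evalEval_shiftInner, ← sub_add_eq_add_sub]
      linear_combination h4
    obtain ⟨N', hN', -, -, hq'⟩ := (h1 (j + j)).exists_degree_of_eq h2
    obtain rfl : N' = 2 * m + 3 := by
      have : (N' : ℂ) = 2 * m + 3 := by
        rw [← hN']
        push_cast at hN ⊢
        linear_combination 2 * hN
      exact_mod_cast this
    have e1 := hq (by omega)
    have e2 := hq' (by omega)
    push_cast at e1 e2
    -- With N = m + 2, the quadratic conditions in degrees N and 2N - 1 = 2m + 3 have the same left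
    -- side 12a(a - 1).
    have e3 : ((m : ℂ) + 1) * (3 * m + 4) = 0 := by linear_combination e1 - e2
    norm_cast at e3

/-- A nonzero action forces p = -(j + 2), so `L_1` and `L_{j+1}` act by zero. Their bracket contains
`L_{j+2}` with factor 1 + p = -(j + 1), which is nonzero. -/
theorem L_add_two (h : PairIdentity p P) (hp : p ≠ 0)
    (hi : P (.L, 0) i = cst p * (del + cst a * lam + cst b)) (j : ℕ) : P (.L, j + 2) i = 0 := by
  by_contra hne
  obtain ⟨hpj, -⟩ := h.L_of_ne_zero hp hi (Nat.succ_ne_zero _) hne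
  have hz : ∀ l : ℕ, l ≠ 0 → l < j + 2 → P (.L, l) i = 0 := fun l hl hlj => by
    by_contra hc
    have := hpj.symm.trans (h.L_of_ne_zero hp hi hl hc).1
    rw [neg_inj] at this
    have := Nat.cast_injective this
    omega
  have h1 : P (.L, j + 2) i * (cst (1 + p) * lam) = 0 := eq_zero_of_evalEval fun t w => by
    have := h.even_left (k := .L) rfl 1 (.L, j + 1) i t 0 w
    simp only [hz 1 one_ne_zero (by omega), hz (j + 1) j.succ_ne_zero (by omega),
      Kind.target, bracketCoeff, show 1 + (j + 1) = j + 2 by omega, evalEval_zero, evalEval_add,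
      evalEval_mul, evalEval_cst, evalEval_del, evalEval_X] at this ⊢
    push_cast at this
    rw [zero_add] at this
    linear_combination this
  simp only [mul_eq_zero, hne, X_ne_zero, C_eq_zero, false_or, or_false] at h1
  rw [hpj] at h1
  push_cast at h1
  have : ((j : ℂ) + 1) = 0 := by linear_combination -h1
  exact Nat.cast_add_one_ne_zero j this

theorem L_one (h : PairIdentity p P) (hp : p ≠ 0)
    (hi : P (.L, 0) i = cst p * (del + cst a * lam + cst b)) :
    ∃ c, (p ≠ -1 → c = 0) ∧ P (.L, 1) i = cst c := by
  by_cases h0 : P (.L, 1) i = 0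
  · exact ⟨0, fun _ => rfl, by rw [cst_zero, h0]⟩
  · obtain ⟨h1, c, hc⟩ := h.L_of_ne_zero hp hi one_ne_zero h0
    exact ⟨c, fun h2 => absurd (by simpa using h1) h2, hc⟩

/-- [W_{j+1} λ G_0] = G_{j+1}, and `W_{j+1}` acts by zero. -/
theorem G_succ (h : PairIdentity p P) {i : ZMod 2}
    (hW : ∀ j l, P (.W, j + 1) l = 0) (j : ℕ) : P (.G, j + 1) i = 0 :=
  eq_zero_of_evalEval fun t w => by
    have := h.even_left (k := .W) rfl (j + 1) (.G, 0) i t 0 w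
    simpa [hW, Kind.target, bracketCoeff] using this.symm

theorem G_zero (h : PairIdentity p P) (hp : p ≠ 0) {a' b' d d' c c' : ℂ}
    (hi : P (.L, 0) i = cst p * (del + cst a * lam + cst b))
    (hi' : P (.L, 0) (i + 1) = cst p * (del + cst a' * lam + cst b'))
    (hc : P (.L, 1) i = cst c) (hc' : P (.L, 1) (i + 1) = cst c')
    (hd : P (.W, 0) i = cst d) (hd' : P (.W, 0) (i + 1) = cst d')
    (hG : P (.G, 1) i = 0) (hne : P (.G, 0) i ≠ 0) :
    b' = b ∧ d' = d + 1 ∧ ∃ σ, σ ≠ 0 ∧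
      ((a' = a + 1 ∧ c' = c ∧ P (.G, 0) i = cst σ) ∨
        (a' = a ∧ c' = 0 ∧ c = 0 ∧ d' = a ∧
          P (.G, 0) i = cst σ * (del + cst a * lam + cst b))) := by
  have hb : b' = b := by
    have h1 := (mul_eq_zero.1 (h.L_zero_eq hp (.G, 0) i)).resolve_left hne
    rw [pairTarget_odd, hi, hi'] at h1
    have h2 := congrArg (evalEval 0 0) h1
    simp [evalEval_rightFactor, evalEval_C] at h2
    apply mul_left_cancel₀ hp
    linear_combination h2
  subst hb
  have hW : ∀ t z w, d' * (P (.G, 0) i).evalEval (t + z) w - d * (P (.G, 0) i).evalEval t w =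
      (P (.G, 0) i).evalEval t (z + w) := fun t z w => by
    have := h.even_left (k := .W) rfl 0 (.G, 0) i t z w
    rw [pairTarget_odd, hd, hd'] at this
    simp only [bracketCoeff, evalEval_cst, evalEval_one, Kind.target] at this
    linear_combination this
  -- [W_0 λ G_0] = G_0 with the parameter of `W_0` equal to 0.
  have hdd : d' = d + 1 := by
    have h1 : P (.G, 0) i * cst (d' - d - 1) = 0 := eq_zero_of_evalEval fun t w => by
      have := hW t 0 w
      rw [zero_add, add_zero] at this
      rw [evalEval_mul, evalEval_cst]
      linear_combination this
    simp only [mul_eq_zero, hne, C_eq_zero, false_or] at h1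
    linear_combination h1
  -- [L_1 λ G_0] is a multiple of `G_1`, which acts by zero.
  have hL : ∀ t z w, c' * (P (.G, 0) i).evalEval (t + z) w =
      c * (P (.G, 0) i).evalEval t w := fun t z w => by
    have := h.even_left (k := .L) rfl 1 (.G, 0) i t z w
    simp only [pairTarget_odd, hc, hc', evalEval_cst, Kind.target, add_zero, hG, evalEval_zero,
      mul_zero] at this
    linear_combination this
  refine ⟨rfl, hdd, ?_⟩
  have h1 := h.isIntertwiner hp (.G, 0) hi (by rw [pairTarget_odd, hi'])
  simp only [Kind.weight, Nat.cast_zero, zero_div, add_zero] at h1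
  obtain ⟨σ, hσ, h2⟩ := h1.eq_of_innerHasse (d := d')
    (fun h0 => hne (eq_zero_of_shiftInner h0)) fun t z w => by
      simp only [evalEval_shiftInner, ← sub_add_eq_add_sub]
      linear_combination hW (t - b') z w - (P (.G, 0) i).evalEval (t - b') w * hdd
  refine ⟨σ, hσ, h2.imp (fun ⟨ha, hg⟩ => ?_) fun ⟨ha, hda, hg⟩ => ?_⟩
  · have hg' : P (.G, 0) i = cst σ :=
      shiftInner_injective b' (hg.trans (shiftInner_cst b' _).symm)
    have := hL 0 0 0
    rw [hg', evalEval_cst, evalEval_cst] at this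
    exact ⟨ha, mul_right_cancel₀ hσ this, hg'⟩
  · have hg' : P (.G, 0) i = cst σ * (del + cst a * lam + cst b') :=
      shiftInner_injective b' <| ext_evalEval fun t w => by
        rw [hg, evalEval_shiftInner]
        simp only [evalEval_mul, evalEval_add, evalEval_cst, evalEval_del, evalEval_X]
        ring
    -- At λ = 0 the linear coefficient is σ(∂ + b'), with root -b'. The first evaluation therefore
    -- isolates c', the second then gives c.
    have l1 := hL (-b') 1 0
    have l2 := hL (1 - b') 0 0
    simp only [hg', evalEval_mul, evalEval_add, evalEval_cst, evalEval_del, evalEval_X] at l1 l2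
    have hc0 : c' = 0 := by
      apply mul_left_cancel₀ hσ
      linear_combination l1
    refine ⟨ha, hc0, ?_, hda, hg'⟩
    apply mul_left_cancel₀ hσ
    rw [hc0] at l2
    linear_combination -l2

end PairIdentity

/-! ### Coordinates of λ-polynomials -/

section Modules

variable {M : Type*} [AddCommGroup M] [Module ℂ[X] M]

/-- The image in `ℂ[∂, λ]` of an element of `M[λ]` under a linear form on `M`. -/
noncomputable def lamCoord (ℓ : M →ₗ[ℂ[X]] ℂ[X]) (q : ℕ →₀ M) : ℂ[X][X] :=
  q.sum fun k m => monomial k (ℓ m)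

theorem coeff_lamCoord (ℓ : M →ₗ[ℂ[X]] ℂ[X]) (q : ℕ →₀ M) (k : ℕ) :
    (lamCoord ℓ q).coeff k = ℓ (q k) := by
  simp only [lamCoord, Finsupp.sum, finsetSum_coeff, coeff_monomial]
  rw [Finset.sum_ite_eq' q.support k fun k => ℓ (q k)]
  split_ifs with h
  · rfl
  · rw [Finsupp.notMem_support_iff.1 h, map_zero]

variable [Module ℂ M] [IsScalarTower ℂ ℂ[X] M]

theorem C_smul_eq (c : ℂ) (m : M) : (C c : ℂ[X]) • m = c • m :=
  algebraMap_smul ℂ[X] c m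

theorem subst_eq_sum (r : ℂ[X]) (q : ℕ →₀ M) : subst r q = q.sum fun k m => r ^ k • m := rfl

theorem eval_lamCoord (ℓ : M →ₗ[ℂ[X]] ℂ[X]) (q : ℕ →₀ M) (r : ℂ[X]) :
    (lamCoord ℓ q).eval r = ℓ (subst r q) := by
  rw [subst_eq_sum, lamCoord, Finsupp.sum, Finsupp.sum, eval_finsetSum, map_sum]
  refine Finset.sum_congr rfl fun k _ => ?_
  rw [eval_monomial, map_smul, smul_eq_mul, mul_comm]

theorem subst_eq_eval_smul {q : ℕ →₀ M} {Q : ℂ[X][X]} {v : M} (h : ∀ k, q k = Q.coeff k • v)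
    (r : ℂ[X]) : subst r q = Q.eval r • v := by
  have h0 : q.support ⊆ Q.support := fun k hk => by
    rw [mem_support_iff]
    intro h1
    rw [Finsupp.mem_support_iff, h, h1, zero_smul] at hk
    exact hk rfl
  rw [subst_eq_sum, Finsupp.sum_of_support_subset q h0 _ fun _ _ => smul_zero _, eval_eq_sum,
    Polynomial.sum, Finset.sum_smul]
  exact Finset.sum_congr rfl fun k _ => by rw [h, smul_smul, mul_comm]

theorem eq_of_subst_eq {κ : Type*} {q q' : ℕ →₀ (κ →₀ ℂ[X])}
    (h : ∀ z : ℂ, subst (C z) q = subst (C z) q') : q = q' := by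
  ext k y : 2
  rw [← Finsupp.lapply_apply (R := ℂ[X]) y (q k), ← Finsupp.lapply_apply (R := ℂ[X]) y (q' k),
    ← coeff_lamCoord, ← coeff_lamCoord]
  congr 1
  refine ext_evalEval fun x w => ?_
  rw [evalEval, evalEval, eval_lamCoord, eval_lamCoord, h]

theorem subst_mapRange {N : Type*} [AddCommGroup N] [Module ℂ N] [Module ℂ[X] N]
    [IsScalarTower ℂ ℂ[X] N] (e : M →ₗ[ℂ[X]] N) (q : ℕ →₀ M) (r : ℂ[X]) :
    subst r (q.mapRange e (map_zero e)) = e (subst r q) := by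
  rw [subst_eq_sum, subst_eq_sum, Finsupp.sum_mapRange_index fun _ => smul_zero _, Finsupp.sum,
    Finsupp.sum, map_sum]
  simp only [map_smul]

end Modules

/-! ### From free modules of rank 1 + 1 to coefficients -/

namespace ConformalModule

variable {S : Type*} [AddCommGroup S] [Module ℂ S] [Module ℂ[X] S] [IsScalarTower ℂ ℂ[X] S]
  {A : LieConformalSuperalgebra S}
  {M : Type*} [AddCommGroup M] [Module ℂ M] [Module ℂ[X] M] [IsScalarTower ℂ ℂ[X] M]
  {N : Type*} [AddCommGroup N] [Module ℂ N] [Module ℂ[X] N] [IsScalarTower ℂ ℂ[X] N]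
  {K : Type*} [AddCommGroup K] [Module ℂ K] [Module ℂ[X] K] [IsScalarTower ℂ ℂ[X] K]

theorem Isomorphic.trans {V : ConformalModule A M} {W : ConformalModule A N}
    {U : ConformalModule A K} (h : V.Isomorphic W) (h' : W.Isomorphic U) : V.Isomorphic U := by
  obtain ⟨e, he, ha⟩ := h
  obtain ⟨f, hf, hb⟩ := h'
  exact ⟨e.trans f, fun i v hv => hf i _ (he i v hv), fun a v k => by
    rw [LinearEquiv.trans_apply, LinearEquiv.trans_apply, hb, ha]⟩

theorem subst_act_smul_left (V : ConformalModule A M) (f : ℂ[X]) (a : S) (v : M) (z : ℂ) :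
    subst (C z) (V.act (f • a) v) = f.comp (-C z) • subst (C z) (V.act a v) := by
  induction f using Polynomial.induction_on generalizing a with
  | C c => rw [C_smul_eq, map_smul, LinearMap.smul_apply, map_smul, C_comp, C_smul_eq]
  | add f g hf hg => rw [add_smul, map_add, LinearMap.add_apply, map_add, hf, hg, add_comp, add_smul]
  | monomial n c ih =>
    rw [pow_succ, ← mul_assoc, mul_smul, ih, V.act_del_left, mul_comp _ X, X_comp, mul_smul,
      neg_smul, C_smul_eq]

theorem subst_act_smul_right (V : ConformalModule A M) (g : ℂ[X]) (a : S) (v : M) (z : ℂ) :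
    subst (C z) (V.act a (g • v)) = g.comp (X + C z) • subst (C z) (V.act a v) := by
  induction g using Polynomial.induction_on generalizing v with
  | C c => rw [C_smul_eq, map_smul, map_smul, C_comp, C_smul_eq]
  | add f g hf hg => rw [add_smul, map_add, map_add, hf, hg, add_comp, add_smul]
  | monomial n c ih =>
    rw [pow_succ, ← mul_assoc, mul_smul, ih, V.act_del_right, mul_comp _ X, X_comp, mul_smul]

/-- ℂ[X] is a principal ideal domain, so each part, a submodule of a free module, is itself free and
of rank one; generators of the two parts together form a basis. -/
theorem IsFreeOfRank.exists_basis {V : ConformalModule A M} (h : V.IsFreeOfRank 1 1) :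
    ∃ b : Module.Basis (ZMod 2) ℂ[X] M, (∀ i, b i ∈ V.part i) ∧
      ∀ i, ∀ v ∈ V.part i, ∃ c : ℂ[X], v = c • b i := by
  obtain ⟨hfree, h0, h1⟩ := h
  have hrank : Module.rank ℂ[X] M = (2 : ℕ) := by
    rw [← Submodule.rank_quotient_add_rank (V.part 0),
      (Submodule.quotientEquivOfIsCompl _ _ V.isCompl).rank_eq, h0, h1]
    norm_num
  have hfin : Module.Finite ℂ[X] M := by
    rw [← Module.rank_lt_aleph0_iff, hrank]
    exact Cardinal.natCast_lt_aleph0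
  have h2 : ∀ i : ZMod 2, Module.rank ℂ[X] (V.part i) = 1 := fun i => by
    obtain rfl | rfl : i = 0 ∨ i = 1 := by
      revert i
      decide
    exacts [by simpa using h0, by simpa using h1]
  have h3 : ∀ i, ∃ v : V.part i, v ≠ 0 ∧ ∀ w : V.part i, ∃ c : ℂ[X], c • v = w := fun i =>
    finrank_eq_one_iff'.1 (Module.rank_eq_one_iff_finrank_eq_one.1 (h2 i))
  choose v hv hspan using h3
  have hspan' : ∀ i, ∀ w ∈ V.part i, ∃ c : ℂ[X], w = c • (v i : M) := fun i w hw => by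
    obtain ⟨c, hc⟩ := hspan i ⟨w, hw⟩
    exact ⟨c, congrArg Subtype.val hc.symm⟩
  have hli : LinearIndependent ℂ[X] fun i => (v i : M) := by
    rw [Fintype.linearIndependent_iff]
    intro g hg
    rw [show ∑ i, g i • (v i : M) = g 0 • (v 0 : M) + g 1 • (v 1 : M) from Fin.sum_univ_two _] at hg
    have m0 : g 0 • (v 0 : M) ∈ V.part 0 := (V.part 0).smul_mem _ (v 0).2
    have m1 : g 0 • (v 0 : M) ∈ V.part 1 := by
      rw [eq_neg_of_add_eq_zero_left hg]
      exact (V.part 1).neg_mem ((V.part 1).smul_mem _ (v 1).2)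
    have z0 : g 0 • (v 0 : M) = 0 := Submodule.disjoint_def.1 V.isCompl.disjoint _ m0 m1
    have z1 : g 1 • (v 1 : M) = 0 := by rwa [z0, zero_add] at hg
    have hv' : ∀ i, (v i : M) ≠ 0 := fun i h => hv i (Subtype.ext h)
    intro i
    obtain rfl | rfl : i = 0 ∨ i = 1 := by
      revert i
      decide
    exacts [(smul_eq_zero.1 z0).resolve_right (hv' 0), (smul_eq_zero.1 z1).resolve_right (hv' 1)]
  have hsp : ⊤ ≤ Submodule.span ℂ[X] (Set.range fun i => (v i : M)) := by
    rw [← V.isCompl.sup_eq_top, sup_le_iff]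
    have : ∀ i, V.part i ≤ Submodule.span ℂ[X] (Set.range fun i => (v i : M)) := fun i w hw => by
      obtain ⟨c, rfl⟩ := hspan' i w hw
      exact Submodule.smul_mem _ _ (Submodule.subset_span ⟨i, rfl⟩)
    exact ⟨this 0, this 1⟩
  refine ⟨Module.Basis.mk hli hsp, fun i => ?_, fun i w hw => ?_⟩
  · rw [Module.Basis.mk_apply]
    exact (v i).2
  · simpa only [Module.Basis.mk_apply] using hspan' i w hw

theorem isomorphic_of_subst {κ : Type*} {V : ConformalModule A M}
    {W : ConformalModule A (κ →₀ ℂ[X])} (e : M ≃ₗ[ℂ[X]] (κ →₀ ℂ[X]))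
    (he : ∀ i, ∀ v ∈ V.part i, e v ∈ W.part i)
    (h : ∀ a v (z : ℂ), subst (C z) (W.act a (e v)) = e (subst (C z) (V.act a v))) :
    V.Isomorphic W := by
  refine ⟨e, he, fun a v k => ?_⟩
  have : W.act a (e v) = (V.act a v).mapRange e (map_zero e) := eq_of_subst_eq fun z => by
    rw [h]
    exact (subst_mapRange e.toLinearMap _ _).symm
  rw [this, Finsupp.mapRange_apply]

/-- A free conformal `𝒮(p)`-module of rank `1 + 1` is given by the action of the generators on
homogeneous basis elements. -/
theorem IsFreeOfRank.exists_isomorphic_pairModule {p : ℂ} {V : ConformalModule (superBlock p) M}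
    (hV : V.IsFreeOfRank 1 1) :
    ∃ (P : Gen → ZMod 2 → ℂ[X][X]) (h : PairIdentity p P), V.Isomorphic (pairModule p P h) := by
  obtain ⟨b, hb, hspan⟩ := hV.exists_basis
  obtain ⟨P, hP⟩ : ∃ P : Gen → ZMod 2 → ℂ[X][X], ∀ x i r,
      subst r (V.act (Finsupp.single x 1) (b i)) = (P x i).eval r • b (pairTarget x i) := by
    -- By parity the action on a basis vector lies in one part, so a single coordinate records it
    -- completely.
    refine ⟨fun x i => lamCoord (b.coord (pairTarget x i)) (V.act (Finsupp.single x 1) (b i)),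
      fun x i r => subst_eq_eval_smul (fun k => ?_) r⟩
    have := V.act_mem x.1.parity i (Finsupp.single x 1)
      (single_mem_freePart (fun x : Gen => x.1.parity) x 1) (b i) (hb i) k
    obtain ⟨c, hc⟩ := hspan _ _ this
    rw [coeff_lamCoord, hc, map_smul, Module.Basis.coord_apply, pairTarget, Module.Basis.repr_self,
      Finsupp.single_eq_same, smul_eq_mul, mul_one]
  have hsub : ∀ x i (f g : ℂ[X]) (z : ℂ), subst (C z) (V.act (Finsupp.single x f) (g • b i)) =
      (f.comp (-C z) * g.comp (X + C z) * (P x i).eval (C z)) • b (pairTarget x i) := by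
    intro x i f g z
    rw [← mul_one f, ← smul_eq_mul, ← Finsupp.smul_single, V.subst_act_smul_left,
      V.subst_act_smul_right, hP, smul_smul, smul_smul, smul_eq_mul, mul_one, mul_assoc]
  have h : PairIdentity p P := by
    intro x x' i z w
    have h1 := V.jacobi x.1.parity x'.1.parity (Finsupp.single x 1)
      (single_mem_freePart (fun x : Gen => x.1.parity) x 1) (Finsupp.single x' 1)
      (single_mem_freePart (fun x : Gen => x.1.parity) x' 1) (b i) z w
    have e1 : pairTarget x (pairTarget x' i) = pairTarget (x.target x') i := by
      simp [pairTarget, Gen.target, Kind.parity_target, add_assoc]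
    have e2 : pairTarget x' (pairTarget x i) = pairTarget (x.target x') i := by
      simp [pairTarget, Gen.target, Kind.parity_target, add_left_comm, add_assoc]
    have e3 : subst (C z) ((superBlock p).bracket (Finsupp.single x 1) (Finsupp.single x' 1)) =
        Finsupp.single (x.target x') ((bracketCoeff p x x').eval (C z)) := by
      rw [superBlock, subst_freeAct, one_comp, one_comp, one_mul, one_mul]
    have e4 := hsub (x.target x') i ((bracketCoeff p x x').eval (C z)) 1 (z + w)
    rw [one_smul, one_comp, mul_one] at e4
    rw [hP, hP, hsub, hsub, e1, e2, e3, e4, one_comp, one_comp, one_mul, one_mul,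
      ← C_smul_eq (paritySign _ _), smul_smul, ← sub_smul] at h1
    have h2 := congrArg (b.coord (pairTarget (x.target x') i)) h1
    simp only [map_smul, Module.Basis.coord_apply, Module.Basis.repr_self, Finsupp.single_eq_same,
      smul_eq_mul, mul_one] at h2
    rw [smul_eq_C_mul, h2]
  refine ⟨P, h, isomorphic_of_subst b.repr (fun i v hv => ?_) fun a v z => ?_⟩
  · obtain ⟨c, rfl⟩ := hspan i v hv
    rw [map_smul, Module.Basis.repr_self]
    exact Submodule.smul_mem _ _ (single_mem_freePart id i 1)
  · obtain ⟨u, rfl⟩ := b.repr.symm.surjective v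
    rw [LinearEquiv.apply_symm_apply]
    induction a using Finsupp.induction_linear with
    | zero => simp
    | add a a' ha ha' => simp only [map_add, LinearMap.add_apply, ha, ha']
    | single x f =>
      induction u using Finsupp.induction_linear with
      | zero => simp
      | add u u' hu hu' => simp only [map_add, hu, hu']
      | single i g =>
        rw [Module.Basis.repr_symm_single, hsub, map_smul, Module.Basis.repr_self,
          Finsupp.smul_single, smul_eq_mul, mul_one, pairModule, subst_freeAct]

end ConformalModule

/-- The isomorphism swaps the two basis vectors. -/
theorem pairModule_isomorphic_parityChange {p : ℂ} {P Q : Gen → ZMod 2 → ℂ[X][X]}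
    (hP : PairIdentity p P) (hQ : PairIdentity p Q) (h : ∀ x i, P x i = Q x (i + 1)) :
    (pairModule p P hP).Isomorphic (pairModule p Q hQ).parityChange := by
  refine ConformalModule.isomorphic_of_subst
    (Finsupp.domLCongr (Equiv.addRight (1 : ZMod 2))) (fun i v hv => ?_) fun a v z => ?_
  · refine freePart_induction (par := id) (α := i) (p := fun v =>
      Finsupp.domLCongr (Equiv.addRight (1 : ZMod 2)) v ∈ freePart id (i + 1)) ?_ ?_ ?_ hv
    · rw [map_zero]
      exact zero_mem _
    · intro u u' hu hu'
      rw [map_add]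
      exact add_mem hu hu'
    · rintro j rfl f
      rw [Finsupp.domLCongr_single]
      exact single_mem_freePart id (j + 1) f
  · induction a using Finsupp.induction_linear with
    | zero => simp
    | add a a' ha ha' => simp only [map_add, LinearMap.add_apply, ha, ha']
    | single x f =>
      induction v using Finsupp.induction_linear with
      | zero => simp
      | add u u' hu hu' => simp only [map_add, hu, hu']
      | single i g =>
        rw [Finsupp.domLCongr_single, ConformalModule.parityChange, pairModule, pairModule,
          subst_freeAct, subst_freeAct, Finsupp.domLCongr_single, h]
        congr 1
        exact (add_assoc _ _ _).symm

/-! ### Classification -/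

theorem add_one_add_one_eq (i : ZMod 2) : i + 1 + 1 = i := by
  revert i
  decide

theorem eq_or_eq_add_one (i j : ZMod 2) : j = i ∨ j = i + 1 := by
  revert i j
  decide

/-- The families of action coefficients. The index `i` is the parity of the element on which the
`G_k` act non-trivially. -/
theorem PairIdentity.classification {p : ℂ} (hp : p ≠ 0) {P : Gen → ZMod 2 → ℂ[X][X]}
    (h : PairIdentity p P) (hne : ∀ i, P (.L, 0) i ≠ 0) :
    (∃ a b c d a' b' c' d' : ℂ, (p ≠ -1 → c = 0 ∧ c' = 0) ∧
      P = sumCoeff p a b c d a' b' c' d') ∨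
    ∃ i : ZMod 2, ∃ σ : ℂ, σ ≠ 0 ∧
      ((∃ a b c d : ℂ, (p ≠ -1 → c = 0) ∧ ∀ x j, P x j = constCoeff p a b c d σ x (j + i)) ∨
        ∃ a b : ℂ, ∀ x j, P x j = linCoeff p a b σ x (j + i)) := by
  choose a b hL using fun i => (h.virasoro hp i).resolve_left (hne i)
  choose c hc hc' using fun i => h.L_one hp (hL i)
  choose d hd using fun i => h.W_zero hp (hL i)
  have hL2 := fun i => h.L_add_two hp (hL i)
  have hW := fun i => h.W_succ hp (hL i)
  have hG := fun i => h.G_succ (i := i) fun j l => hW l j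
  by_cases hex : ∃ i, P (.G, 0) i ≠ 0
  · right
    obtain ⟨i, hi⟩ := hex
    obtain ⟨hb, hdd, σ, hσ, hg⟩ := h.G_zero hp (hL i) (hL (i + 1)) (hc' i) (hc' (i + 1)) (hd i)
      (hd (i + 1)) (hG i 0) hi
    -- Otherwise going from v_i to v_{i+1} and back would raise the `W_0` eigenvalue by 2.
    have hi' : P (.G, 0) (i + 1) = 0 := by
      by_contra hi'
      have h1 := (h.G_zero hp (hL (i + 1)) (hL (i + 1 + 1)) (hc' (i + 1)) (hc' (i + 1 + 1))
        (hd (i + 1)) (hd (i + 1 + 1)) (hG (i + 1) 0) hi').2.1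
      rw [add_one_add_one_eq] at h1
      have : (2 : ℂ) = 0 := by linear_combination -hdd - h1
      exact two_ne_zero this
    -- The shift by i carries the source of `G_0` to index 0, where the model families have theirs.
    have e0 : i + i = 0 := CharTwo.add_self_eq_zero i
    have e1 : i + 1 + i = 1 := by rw [add_right_comm, e0, zero_add]
    refine ⟨i, σ, hσ, hg.imp (fun ⟨ha, hcc, hG0⟩ => ?_) fun ⟨ha, hcc, hcc', hda, hG0⟩ => ?_⟩
    · refine ⟨a i, b i, c i, d i, hc i, fun ⟨k, m⟩ j => ?_⟩
      obtain rfl | rfl := eq_or_eq_add_one i j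
      · rw [e0]
        rcases k with _ | _ | _ <;> rcases m with _ | _ | m <;>
          simp [constCoeff, hL, hc', hL2, hd, hW, hG0, hG]
      · rw [e1]
        rcases k with _ | _ | _ <;> rcases m with _ | _ | m <;>
          simp [constCoeff, hL, hc', hL2, hd, hW, hi', hG, ha, hb, hcc, hdd]
    · refine ⟨a i, b i, fun ⟨k, m⟩ j => ?_⟩
      have hda' : d i = a i - 1 := by linear_combination hda - hdd
      obtain rfl | rfl := eq_or_eq_add_one i j
      · rw [e0]
        rcases k with _ | _ | _ <;> rcases m with _ | _ | m <;>
          simp [linCoeff, hL, hc', hL2, hd, hW, hG0, hG, hcc', hda']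
      · rw [e1]
        rcases k with _ | _ | _ <;> rcases m with _ | _ | m <;>
          simp [linCoeff, hL, hc', hL2, hd, hW, hi', hG, ha, hb, hcc, hda]
  · left
    push Not at hex
    refine ⟨a 0, b 0, c 0, d 0, a 1, b 1, c 1, d 1, fun hp1 => ⟨hc 0 hp1, hc 1 hp1⟩, ?_⟩
    funext ⟨k, m⟩ j
    obtain rfl | rfl : j = 0 ∨ j = 1 := eq_or_eq_add_one 0 j
    all_goals
      rcases k with _ | _ | _ <;> rcases m with _ | _ | m <;>
        simp [sumCoeff, hL, hc', hL2, hd, hW, hex, hG]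

/-- The contrapositive of `eq_zero_of_L_zero`, extended from generators to the whole superalgebra by
linearity. -/
theorem PairIdentity.L_zero_ne_zero {p : ℂ} (hp : p ≠ 0) {P : Gen → ZMod 2 → ℂ[X][X]}
    (h : PairIdentity p P) {i : ZMod 2} (hn : (pairModule p P h).ActsNontriviallyOn i) :
    P (.L, 0) i ≠ 0 := fun h0 => by
  obtain ⟨a, v, hv, hav⟩ := hn
  apply hav
  clear hav
  induction a using Finsupp.induction_linear with
  | zero => rw [map_zero, LinearMap.zero_apply]
  | add a a' ha ha' =>
    rw [map_add, LinearMap.add_apply, ha, ha', add_zero]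
  | single x f =>
    refine freePart_induction (par := id) (α := i)
      (p := fun v => (pairModule p P h).act (Finsupp.single x f) v = 0) (map_zero _) ?_ ?_ hv
    · intro u u' hu hu'
      rw [map_add, hu, hu', add_zero]
    · rintro j rfl g
      rw [pairModule, freeAct_single, show P x j = 0 from h.eq_zero_of_L_zero hp h0 x, mul_zero,
        map_zero]

theorem ConformalModule.Isomorphic.actsNontriviallyOn {S : Type*} [AddCommGroup S] [Module ℂ S]
    [Module ℂ[X] S] [IsScalarTower ℂ ℂ[X] S] {A : LieConformalSuperalgebra S}
    {M : Type*} [AddCommGroup M] [Module ℂ M] [Module ℂ[X] M] [IsScalarTower ℂ ℂ[X] M]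
    {N : Type*} [AddCommGroup N] [Module ℂ N] [Module ℂ[X] N] [IsScalarTower ℂ ℂ[X] N]
    {V : ConformalModule A M} {W : ConformalModule A N} (h : V.Isomorphic W) {i : ZMod 2}
    (hV : V.ActsNontriviallyOn i) : W.ActsNontriviallyOn i := by
  obtain ⟨e, he, hact⟩ := h
  obtain ⟨a, v, hv, hav⟩ := hV
  refine ⟨a, e v, he i v hv, fun h0 => hav (Finsupp.ext fun k => ?_)⟩
  have := hact a v k
  rw [h0, Finsupp.zero_apply] at this
  exact e.map_eq_zero_iff.1 this.symm

end LieConformal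

theorem mainTheorem3 (p : ℂ) (hp : p ≠ 0)
    {M : Type*} [AddCommGroup M] [Module ℂ M] [Module ℂ[X] M] [IsScalarTower ℂ ℂ[X] M]
    (V : LieConformal.ConformalModule (LieConformal.superBlock p) M)
    (hfree : V.IsFreeOfRank 1 1)
    (hnontriv : ∀ i : ZMod 2, V.ActsNontriviallyOn i) :
    (∃ (a b c d a' b' c' d' : ℂ) (h : p ≠ -1 → c = 0 ∧ c' = 0),
      V.Isomorphic (LieConformal.sumModule p a b c d a' b' c' d' h)) ∨
    (∃ (a b c d σ : ℂ) (h : p ≠ -1 → c = 0), σ ≠ 0 ∧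
      V.Isomorphic (LieConformal.constModule p a b c d σ h)) ∨
    (∃ a b σ : ℂ, σ ≠ 0 ∧
      V.Isomorphic (LieConformal.linModule p a b σ)) ∨
    (∃ (a b c d σ : ℂ) (h : p ≠ -1 → c = 0), σ ≠ 0 ∧
      V.Isomorphic (LieConformal.constModule p (a - 1) b c (d - 1) σ h).parityChange) ∨
    (∃ a b σ : ℂ, σ ≠ 0 ∧
      V.Isomorphic (LieConformal.linModule p a b σ).parityChange) := by
  obtain ⟨P, h, hiso⟩ := hfree.exists_isomorphic_pairModule
  have hne := fun i => h.L_zero_ne_zero hp (hiso.actsNontriviallyOn (hnontriv i))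
  obtain ⟨a, b, c, d, a', b', c', d', hc, rfl⟩ | ⟨i, σ, hσ, hP⟩ := h.classification hp hne
  · exact Or.inl ⟨a, b, c, d, a', b', c', d', hc, hiso⟩
  obtain rfl | rfl : i = 0 ∨ i = 1 := LieConformal.eq_or_eq_add_one 0 i
  · simp only [add_zero] at hP
    obtain ⟨a, b, c, d, hc, hP⟩ | ⟨a, b, hP⟩ := hP
    · obtain rfl : P = LieConformal.constCoeff p a b c d σ := funext fun x => funext (hP x)
      exact Or.inr (Or.inl ⟨a, b, c, d, σ, hc, hσ, hiso⟩)
    · obtain rfl : P = LieConformal.linCoeff p a b σ := funext fun x => funext (hP x)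
      exact Or.inr (Or.inr (Or.inl ⟨a, b, σ, hσ, hiso⟩))
  · obtain ⟨a, b, c, d, hc, hP⟩ | ⟨a, b, hP⟩ := hP
    -- The parity-changed family is labelled by the even part, which is now the target of `G_0`:
    -- hence a + 1 and d + 1.
    · refine Or.inr (Or.inr (Or.inr (Or.inl ⟨a + 1, b, c, d + 1, σ, hc, hσ, ?_⟩)))
      simp only [add_sub_cancel_right]
      exact hiso.trans (LieConformal.pairModule_isomorphic_parityChange h _ hP)
    · exact Or.inr (Or.inr (Or.inr (Or.inr ⟨a, b, σ, hσ,
        hiso.trans (LieConformal.pairModule_isomorphic_parityChange h _ hP)⟩)))
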